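/- Setting. A mixed graph $G=(V,D,B)$ has a finite vertex set $V$, directed edges $D\subset V\times V$ ($u\to v$) and symmetric bidirected edges $B\subset V\times V$ ($u\leftrightarrow v$), both without self-loops. Its parameter space $\Theta$ is the set of pairs $(\Lambda,\Omega)$ of real $V\times V$ matrices such that $\lambda_{uv}\neq0$ implies $u\to v\in G$, $I-\Lambda$ is invertible, $\Omega$ is positive definite, and $\omega_{uv}\ne 0$ with $u\neq v$ implies $u\leftrightarrow v\in G$. Put $\Sigma=\phi_G(\Lambda,\Omega)=(I-\Lambda)^{-T}\Omega(I-\Lambda)^{-1}$. A property holds generically if it holds on $\Theta\setminus A$ for some proper algebraic subset $A\subsetneq\Theta$ (the common zero set in $\Theta$ of a collection of polynomials in the entries of $\Lambda,\Omega$). An edge $u\to v$ is generically identifiable if, generically, every $(\Lambda',\Omega')\in\Theta$ with $\phi_G(\Lambda',\Omega')=\phi_G(\Lambda,\Omega)$ has $\lambda'_{uv}=\lambda_{uv}$. It is rationally identifiable if there is a rational function $\psi$ of the entries of $\Sigma$ such that, generically, $\psi$ is defined at $\phi_G(\Lambda,\Omega)$ and $\psi(\phi_G(\Lambda,\Omega))=\lambda_{uv}$;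 then we say that $\psi$ identifies $u\to v$. Let $\mathrm{des}(v)$ be the set of endpoints of non-empty directed paths from $v$. Let $G_{\mathrm{flow}}$ be the directed graph on $V\sqcup V'$, where $V'=\{i':i\in V\}$ is a copy of $V$, with edges $i\to j$ if $j\to i\in G$; $i\to i'$ for all $i$; $i\to j'$ if $i\leftrightarrow j\in G$; and $i'\to j'$ if $i\to j\in G$. Max-flows are taken with capacity $1$ on all edges and all vertices. Theorem. Let $w_0,w_1,\dots,w_\ell$ be distinct vertices with $w_i\to v\in G$ for $0\le i\le\ell$, where $\ell\ge 0$, and let $G^*_{\mathrm{flow}}$ be $G_{\mathrm{flow}}$ with the edges $w_0'\to v',\dots,w_\ell'\to v'$ removed. Suppose there are $S\subset V$ and $T\subset V\setminus\{v,w_0\}$ with $|S|=|T|+1=k$ such that (a) $\mathrm{des}(v)\cap(T\cup\{v\})=\emptyset$; (b) the max-flow from $S$ to $T'\cup\{w_0'\}$ in $G_{\mathrm{flow}}$ equals $k$; (c) the max-flow from $S$ to $T'\cup\{v'\}$ in $G^*_{\mathrm{flow}}$ is less than $k$. For $x\in V$ let $|\Sigma_{S,T\cup\{x\}}|$ be the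 determinant of the $k\times k$ matrix whose rows are indexed by $S$ and whose columns are the columns of $\Sigma$ indexed by $T$ followed by the column indexed by $x$ (with fixed orderings of $S$ and $T$); it is zero if $x\in T$. Then, generically, $|\Sigma_{S,T\cup\{w_0\}}|\neq 0$ and $$\lambda_{w_0v}=\frac{|\Sigma_{S,T\cup\{v\}}|-\sum_{i=1}^{\ell}\lambda_{w_iv}\,|\Sigma_{S,T\cup\{w_i\}}|}{|\Sigma_{S,T\cup\{w_0\}}|}.$$ Consequently, if all the edges $w_1\to v,\dots,w_\ell\to v$ are generically (respectively rationally) identifiable, then $w_0\to v$ is generically (respectively rationally) identifiable. Moreover, if rational functions $\psi_1,\dots,\psi_\ell$ identify $w_1\to v,\dots,w_\ell\to v$, then the rational function obtained from the displayed right-hand side by replacing each $\lambda_{w_iv}$ by $\psi_i(\Sigma)$ identifies $w_0\to v$. -/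

import Mathlib

open scoped BigOperators

noncomputable section

/-! ### Maximum flows in networks with unit edge and vertex capacities -/

/-- A real-valued flow from the set `S` to the set `T` in the directed graph `E` on `α`, in which
all edges and all vertices have capacity one. `f x y` is the flow along the edge `x → y`,
`a x` is the flow that enters the network at `x` (from a super-source joined to the vertices
of `S`) and `b x` is the flow that leaves it at `x` (to a super-sink joined to the vertices
of `T`). The field `cap_vertex` bounds the total flow through each vertex; together with `conserve`
it also gives `a x ≤ 1` and `b x ≤ 1`. -/
structure IsUnitFlow {α : Type*} [Fintype α] (E : α → α → Prop) (S T : Set α)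
    (f : α → α → ℝ) (a b : α → ℝ) : Prop where
  nonneg : ∀ x y, 0 ≤ f x y
  cap_edge : ∀ x y, f x y ≤ 1
  support : ∀ x y, ¬ E x y → f x y = 0
  source_nonneg : ∀ x, 0 ≤ a x
  source_support : ∀ x, x ∉ S → a x = 0
  sink_nonneg : ∀ x, 0 ≤ b x
  sink_support : ∀ x, x ∉ T → b x = 0
  conserve : ∀ x, a x + ∑ y, f y x = (∑ y, f x y) + b x
  cap_vertex : ∀ x, a x + ∑ y, f y x ≤ 1

/-- The set of values of all flows from `S` to `T`. -/
def unitFlowValues {α : Type*} [Fintype α] (E : α → α → Prop) (S T : Set α) : Set ℝ :=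
  {r | ∃ f a b, IsUnitFlow E S T f a b ∧ r = ∑ x, a x}

/-- The max-flow from `S` to `T` (unit capacities on edges and vertices). -/
def maxFlow {α : Type*} [Fintype α] (E : α → α → Prop) (S T : Set α) : ℝ :=
  sSup (unitFlowValues E S T)

/-- The supremum in `maxFlow` is attained: it is a maximum. -/
theorem isGreatest_maxFlow {α : Type*} [Fintype α] (E : α → α → Prop) (S T : Set α) :
    IsGreatest (unitFlowValues E S T) (maxFlow E S T) := by
  have hK : IsCompact {p : (α → α → ℝ) × (α → ℝ) × (α → ℝ) |
      IsUnitFlow E S T p.1 p.2.1 p.2.2} := by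
    have hbox : IsCompact (Set.Icc (0 : (α → α → ℝ) × (α → ℝ) × (α → ℝ)) 1) := isCompact_Icc
    refine hbox.of_isClosed_subset ?_ ?_
    · have : {p : (α → α → ℝ) × (α → ℝ) × (α → ℝ) | IsUnitFlow E S T p.1 p.2.1 p.2.2} =
          {p | (∀ x y, 0 ≤ p.1 x y) ∧ (∀ x y, p.1 x y ≤ 1) ∧ (∀ x y, ¬ E x y → p.1 x y = 0) ∧
            (∀ x, 0 ≤ p.2.1 x) ∧ (∀ x, x ∉ S → p.2.1 x = 0) ∧ (∀ x, 0 ≤ p.2.2 x) ∧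
            (∀ x, x ∉ T → p.2.2 x = 0) ∧
            (∀ x, p.2.1 x + ∑ y, p.1 y x = (∑ y, p.1 x y) + p.2.2 x) ∧
            (∀ x, p.2.1 x + ∑ y, p.1 y x ≤ 1)} := by
        ext p
        exact ⟨fun h => ⟨h.1, h.2, h.3, h.4, h.5, h.6, h.7, h.8, h.9⟩,
          fun ⟨h1, h2, h3, h4, h5, h6, h7, h8, h9⟩ => ⟨h1, h2, h3, h4, h5, h6, h7, h8, h9⟩⟩
      rw [this]
      simp only [Set.ofPred_and, Set.ofPred_forall]
      refine IsClosed.inter ?_ (IsClosed.inter ?_ (IsClosed.inter ?_ (IsClosed.inter ?_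
        (IsClosed.inter ?_ (IsClosed.inter ?_ (IsClosed.inter ?_ (IsClosed.inter ?_ ?_)))))))
      all_goals
        repeat (refine isClosed_iInter fun _ => ?_)
        first
          | exact isClosed_le (by fun_prop) (by fun_prop)
          | exact isClosed_eq (by fun_prop) (by fun_prop)
    · rintro ⟨f, a, b⟩ h
      have hin : ∀ x, 0 ≤ ∑ y, f y x := fun x => Finset.sum_nonneg fun y _ => h.nonneg y x
      have hout : ∀ x, 0 ≤ ∑ y, f x y := fun x => Finset.sum_nonneg fun y _ => h.nonneg x y
      refine ⟨⟨fun x y => h.nonneg x y, fun x => h.source_nonneg x, fun x => h.sink_nonneg x⟩,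
        ⟨fun x y => h.cap_edge x y, fun x => ?_, fun x => ?_⟩⟩
      · have := h.cap_vertex x
        have := hin x
        simp only [Prod.snd_one, Prod.fst_one, Pi.one_apply]
        linarith
      · have := h.cap_vertex x
        have := h.conserve x
        have := hout x
        simp only [Prod.snd_one, Pi.one_apply]
        linarith
  have hV : unitFlowValues E S T = (fun p : (α → α → ℝ) × (α → ℝ) × (α → ℝ) => ∑ x, p.2.1 x) ''
      {p | IsUnitFlow E S T p.1 p.2.1 p.2.2} := by
    ext r
    constructor
    · rintro ⟨f, a, b, h, rfl⟩
      exact ⟨(f, a, b), h, rfl⟩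
    · rintro ⟨⟨f, a, b⟩, h, rfl⟩
      exact ⟨f, a, b, h, rfl⟩
  have hC : IsCompact (unitFlowValues E S T) := by
    rw [hV]
    exact hK.image (by fun_prop)
  have hne : (unitFlowValues E S T).Nonempty :=
    ⟨0, 0, 0, 0, by constructor <;> simp, by simp⟩
  exact hC.isGreatest_sSup hne

/-! ### Mixed graphs and the covariance parametrization -/

/-- A mixed graph: `dir v w` means `v → w`, `bi v w` means `v ↔ w`. -/
structure MixedGraph (V : Type*) where
  dir : V → V → Prop
  bi : V → V → Prop
  dir_irrefl : ∀ v, ¬ dir v v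
  bi_irrefl : ∀ v, ¬ bi v v
  bi_symm : ∀ v w, bi v w → bi w v

/-- The pairs `(Λ, Ω)` of matrices with rows and columns indexed by `V`. -/
abbrev ParamPair (V : Type*) : Type _ := Matrix V V ℝ × Matrix V V ℝ

/-- Polynomials in the entries of `Λ` (left variables) and of `Ω` (right variables). -/
abbrev ParamPoly (V : Type*) : Type _ := MvPolynomial ((V × V) ⊕ (V × V)) ℝ

/-- The value of a polynomial at `(Λ, Ω)`. -/
def ParamPoly.evalAt {V : Type*} (p : ParamPoly V) (θ : ParamPair V) : ℝ :=
  MvPolynomial.eval (Sum.elim (fun e => θ.1 e.1 e.2) (fun e => θ.2 e.1 e.2)) p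

/-- Rational functions, with real coefficients, in the entries of a matrix indexed by `V`. -/
abbrev RatFun (V : Type*) : Type _ := FractionRing (MvPolynomial (V × V) ℝ)

/-- The rational function `ψ` is defined at the matrix `M` and has the value `c` there. -/
def RatFun.HasValueAt {V : Type*} (ψ : RatFun V) (M : Matrix V V ℝ) (c : ℝ) : Prop :=
  ∃ p q : MvPolynomial (V × V) ℝ,
    MvPolynomial.eval (fun e => M e.1 e.2) q ≠ 0 ∧
    ψ = algebraMap _ (RatFun V) p / algebraMap _ (RatFun V) q ∧
    c = MvPolynomial.eval (fun e => M e.1 e.2) p / MvPolynomial.eval (fun e => M e.1 e.2) q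

/-- The matrix `(σ_{uv})` of coordinate functions, as a matrix of rational functions. -/
def coordMatrix (V : Type*) : Matrix V V (RatFun V) :=
  Matrix.of fun u v => algebraMap (MvPolynomial (V × V) ℝ) (RatFun V) (MvPolynomial.X (u, v))

/-- The subdeterminant `|M_{S, T ∪ {x}}|`, where `S` is listed as `s` and the columns are those
of `T` in the order `t`, followed by the column `x`. It vanishes when `x ∈ T`. -/
def extSubdet {V R : Type*} [CommRing R] {m : ℕ} (M : Matrix V V R)
    (s : Fin (m + 1) → V) (t : Fin m → V) (x : V) : R :=
  (M.submatrix s (Fin.snoc t x : Fin (m + 1) → V)).det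

/-- The ratio
`(|M_{S, T ∪ {v}}| - ∑ i, c i * |M_{S, T ∪ {w i}}|) / |M_{S, T ∪ {w₀}}|`. -/
def detRatio {V K : Type*} [Field K] {m l : ℕ} (M : Matrix V V K)
    (s : Fin (m + 1) → V) (t : Fin m → V) (v w₀ : V) (w : Fin l → V) (c : Fin l → K) : K :=
  (extSubdet M s t v - ∑ i, c i * extSubdet M s t (w i)) / extSubdet M s t w₀

namespace MixedGraph

variable {V : Type*} (G : MixedGraph V)

/-- The descendants of `v`: the endpoints of non-empty directed paths from `v`. -/
def des (v : V) : Set V := {w | Relation.TransGen G.dir v w}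

/-- The flow graph of `G` on two copies of `V`; `Sum.inl i` is `i` and `Sum.inr i` is `i'`. -/
def flowGraph : V ⊕ V → V ⊕ V → Prop
  | Sum.inl i, Sum.inl j => G.dir j i
  | Sum.inl i, Sum.inr j => i = j ∨ G.bi i j
  | Sum.inr i, Sum.inr j => G.dir i j
  | Sum.inr _, Sum.inl _ => False

/-- The flow graph of `G` with the edges `u' → v'`, `u ∈ W`, removed. -/
def flowGraphDelete (W : Set V) (v : V) (x y : V ⊕ V) : Prop :=
  G.flowGraph x y ∧ ¬ ((∃ u ∈ W, x = Sum.inr u) ∧ y = Sum.inr v)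

variable [Fintype V] [DecidableEq V]

/-- The parameter space: `Λ` is supported on the directed edges and `I - Λ` is invertible;
`Ω` is positive definite and its off-diagonal support lies in the bidirected edges. -/
def paramSpace : Set (ParamPair V) :=
  {θ | (∀ v w, θ.1 v w ≠ 0 → G.dir v w) ∧ IsUnit (1 - θ.1) ∧
    θ.2.PosDef ∧ ∀ v w, v ≠ w → θ.2 v w ≠ 0 → G.bi v w}

/-- The covariance matrix `(I - Λ)⁻ᵀ Ω (I - Λ)⁻¹`. -/
def covariance (θ : ParamPair V) : Matrix V V ℝ :=
  ((1 - θ.1)⁻¹).transpose * θ.2 * (1 - θ.1)⁻¹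

/-- The fiber of the covariance parametrization through `θ`. -/
def fiber (θ : ParamPair V) : Set (ParamPair V) :=
  {θ' ∈ G.paramSpace | covariance θ' = covariance θ}

/-- `A` is a proper algebraic subset of the parameter space. -/
def IsProperAlgebraic (A : Set (ParamPair V)) : Prop :=
  (∃ P : Set (ParamPoly V), A = {θ ∈ G.paramSpace | ∀ p ∈ P, p.evalAt θ = 0}) ∧
    A ≠ G.paramSpace

/-- A property holds generically: off a proper algebraic subset of the parameter space. -/
def Generically (Q : ParamPair V → Prop) : Prop :=
  ∃ A, G.IsProperAlgebraic A ∧ ∀ θ ∈ G.paramSpace \ A, Q θ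

/-- The edge `u → v` is generically identifiable. -/
def GenericallyIdentifiable (u v : V) : Prop :=
  G.Generically fun θ => (fun θ' : ParamPair V => θ'.1 u v) '' G.fiber θ = {θ.1 u v}

/-- The rational function `ψ` of the covariance matrix recovers the coefficient of the edge
`u → v` generically. -/
def RationallyIdentifiedBy (ψ : RatFun V) (u v : V) : Prop :=
  G.Generically fun θ => ψ.HasValueAt (covariance θ) (θ.1 u v)

/-- The edge `u → v` is rationally identifiable. -/
def RationallyIdentifiable (u v : V) : Prop :=
  ∃ ψ : RatFun V, G.RationallyIdentifiedBy ψ u v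

end MixedGraph

end

open scoped BigOperators

noncomputable section


/-! ### Sums and cardinalities over complements and ranges -/

/-! Flows and determinants are compared through bijections; no path expansion is used and no
acyclicity is needed. A flow saturating a source and a sink of equal size amounts to a bijection
from the complement of the sink onto the complement of the source that fixes each point or moves it
along an edge (`ncard_mem_unitFlowValues_of_equiv`, `exists_equiv_of_ncard_mem_unitFlowValues`).
Leibniz terms of complementary minors supply such bijections.

For the formula, let `u` carry the coefficients of the edges `w i → v`, including `w₀ → v`. By
linearity in the last column, the claim is that the minor of Σ with columns `T` and Σ(e_v − u)
vanishes. If it did not, hypothesis (a) would make a complementary minor of a block matrix with the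
sparsity of the reduced flow graph nonzero. One of its Leibniz terms would then give a saturating
flow, against (c). Hence the relation holds at every parameter (`extSubdet_eq_sum_of_maxFlow_lt`).

For the denominator, the bijection obtained from (b) splits into a partial injection on each copy of
`V`, joined by crossings (`exists_crossings`). Weights along each injection make one minor of (1 −
Λ)⁻¹ nonzero. Interpolation makes the two minors nonzero together, and Ω close to LᵀL makes the
minor of Σ nearly their product (`exists_det_covariance_ne_zero_of_maxFlow`). Nonvanishing at one
parameter is generic nonvanishing. -/

open Classical in
theorem sum_notMem_eq_sum {α M : Type*} [Fintype α] [AddCommMonoid M] {U : Set α} {F : α → M}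
    (hF : ∀ x ∈ U, F x = 0) : ∑ x : {x // x ∉ U}, F x = ∑ x, F x := by
  rw [← Finset.sum_subtype (Finset.univ.filter fun x => x ∉ U) (by simp) F]
  exact Finset.sum_filter_of_ne fun x _ hx hU => hx (hF x hU)

theorem sum_eq_sum_of_injective {α k M : Type*} [Fintype α] [Fintype k] [AddCommMonoid M]
    {t : k → α} (ht : Function.Injective t) {F : α → M} (hF : ∀ x ∉ Set.range t, F x = 0) :
    ∑ x, F x = ∑ i, F (t i) :=
  (Fintype.sum_of_injective t ht _ _ hF fun _ => rfl).symm

open Classical in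
theorem card_notMem_eq {α : Type*} [Fintype α] {S T : Set α} (hcard : S.ncard = T.ncard) :
    Fintype.card {x // x ∉ T} = Fintype.card {y // y ∉ S} := by
  have h1 := Set.ncard_add_ncard_compl S
  have h2 := Set.ncard_add_ncard_compl T
  have h3 : Fintype.card {x // x ∉ T} = Tᶜ.ncard := by
    rw [← Nat.card_eq_fintype_card]; rfl
  have h4 : Fintype.card {x // x ∉ S} = Sᶜ.ncard := by
    rw [← Nat.card_eq_fintype_card]; rfl
  omega

/-! ### Unit flows and bijections between complements -/

open Classical in
/-- A bijection from the complement of `T` to the complement of `S` that moves points along edges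
gives a unit flow from `S` to `T` saturating `S`. -/
theorem ncard_mem_unitFlowValues_of_equiv {α : Type*} [Fintype α] {E : α → α → Prop} {S T : Set α}
    (τ : {x // x ∉ T} ≃ {y // y ∉ S}) (hτ : ∀ x, (τ x : α) ≠ x → E x (τ x)) :
    (S.ncard : ℝ) ∈ unitFlowValues E S T := by
  -- One unit runs along each edge `x → τ x`; a fixed point of `τ` is a vertex that the flow does
  -- not use.
  let f : α → α → ℝ := fun x y => if h : x ∉ T then (if (τ ⟨x, h⟩ : α) = y ∧ y ≠ x then 1 else 0) else 0
  let a : α → ℝ := fun x => if x ∈ S then 1 else 0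
  let b : α → ℝ := fun x => if x ∈ T then 1 else 0
  let fixed : α → Prop := fun x => ∃ h : x ∉ T, (τ ⟨x, h⟩ : α) = x
  have hout : ∀ x, ∑ y, f x y = if x ∈ T ∨ fixed x then 0 else 1 := by
    intro x
    by_cases hT : x ∈ T
    · simp [f, hT]
    · by_cases hx : (τ ⟨x, hT⟩ : α) = x
      · have hfx : fixed x := ⟨hT, hx⟩
        rw [if_pos (Or.inr hfx)]
        refine Finset.sum_eq_zero fun y _ => ?_
        simp only [f, hT, hx, not_false_eq_true, dif_pos]
        exact if_neg fun h => h.2 h.1.symm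
      · have hfx : ¬ fixed x := fun ⟨_, h⟩ => hx h
        rw [if_neg (by tauto), Finset.sum_eq_single (τ ⟨x, hT⟩ : α)]
        · simp [f, hT, hx]
        · intro y _ hy
          simp only [f, hT, not_false_eq_true, dif_pos]
          exact if_neg fun h => hy h.1.symm
        · simp
  have hin : ∀ y, ∑ x, f x y = if y ∈ S ∨ fixed y then 0 else 1 := by
    intro y
    by_cases hS : y ∈ S
    · rw [if_pos (Or.inl hS)]
      refine Finset.sum_eq_zero fun x _ => ?_
      simp only [f]
      split_ifs with h1 h2
      · rfl
      · exact absurd hS (h2.1 ▸ (τ ⟨x, h1⟩).2)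
      · rfl
    · obtain ⟨⟨z, hz⟩, hzy⟩ := τ.surjective ⟨y, hS⟩
      have key : ∀ x (h : x ∉ T), (τ ⟨x, h⟩ : α) = y → x = z := by
        intro x h hx
        have : τ ⟨x, h⟩ = τ ⟨z, hz⟩ := by rw [hzy]; exact Subtype.ext hx
        exact congrArg Subtype.val (τ.injective this)
      by_cases hy : fixed y
      · rw [if_pos (Or.inr hy)]
        refine Finset.sum_eq_zero fun x _ => ?_
        simp only [f]
        split_ifs with h1 h2
        · rfl
        · obtain ⟨h3, h4⟩ := hy
          exact absurd ((key y h3 h4).trans (key x h1 h2.1).symm) h2.2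
        · rfl
      · rw [if_neg (by tauto), Finset.sum_eq_single z]
        · simp only [f, hz, not_false_eq_true, dif_pos, hzy]
          refine if_pos ⟨trivial, ?_⟩
          rintro rfl
          exact hy ⟨hz, by rw [hzy]⟩
        · intro x _ hx
          simp only [f]
          split_ifs with h1 h2
          · rfl
          · exact absurd (key x h1 h2.1) hx
          · rfl
        · simp
  have hfixS : ∀ x, fixed x → x ∉ S := fun x ⟨h, hx⟩ => hx ▸ (τ ⟨x, h⟩).2
  have hfixT : ∀ x, fixed x → x ∉ T := fun x ⟨h, _⟩ => h
  refine ⟨f, a, b, ⟨?_, ?_, ?_, ?_, ?_, ?_, ?_, ?_, ?_⟩, ?_⟩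
  · intro x y
    simp only [f]
    split_ifs <;> norm_num
  · intro x y
    simp only [f]
    split_ifs <;> norm_num
  · intro x y hxy
    simp only [f]
    split_ifs with h1 h2
    · rfl
    · obtain ⟨rfl, h3⟩ := h2
      exact absurd (hτ ⟨x, h1⟩ h3) hxy
    · rfl
  · intro x
    simp only [a]
    split_ifs <;> norm_num
  · intro x hx
    simp [a, hx]
  · intro x
    simp only [b]
    split_ifs <;> norm_num
  · intro x hx
    simp [b, hx]
  · intro x
    rw [hin, hout]
    have h1 := hfixS x
    have h2 := hfixT x
    by_cases hS : x ∈ S <;> by_cases hT : x ∈ T <;> by_cases hf : fixed x <;>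
      simp [a, b, hS, hT, hf] <;> tauto
  · intro x
    rw [hin]
    by_cases hS : x ∈ S <;> by_cases hf : fixed x <;> simp [a, hS, hf]
  · simp [a, Finset.sum_boole, Set.ncard_eq_toFinset_card', Set.toFinset]

open Classical in
/-- A unit flow that saturates the source and the sink yields a bijection from the complement of
the sink to the complement of the source that moves points along edges. -/
theorem exists_equiv_of_ncard_mem_unitFlowValues {α : Type*} [Fintype α] {E : α → α → Prop}
    {S T : Set α} (hcard : S.ncard = T.ncard) (hflow : (S.ncard : ℝ) ∈ unitFlowValues E S T) :
    ∃ τ : {x // x ∉ T} ≃ {y // y ∉ S}, ∀ x, (τ x : α) ≠ x → E x (τ x) := by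
  obtain ⟨f, a, b, h, hsum⟩ := hflow
  have hin : ∀ x, 0 ≤ ∑ y, f y x := fun x => Finset.sum_nonneg fun y _ => h.nonneg y x
  have hout : ∀ x, 0 ≤ ∑ y, f x y := fun x => Finset.sum_nonneg fun y _ => h.nonneg x y
  -- Terms bounded by 1 and supported on `U` can add up to `U.ncard` only if each term on `U` is 1.
  have hsat : ∀ (U : Set α) (c : α → ℝ), (∀ x, c x ≤ 1) → (∀ x ∉ U, c x = 0) →
      ∑ x, c x = U.ncard → ∀ x ∈ U, c x = 1 := by
    intro U c hc1 hc0 hcs x hx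
    have hle : ∀ x ∈ Finset.univ, c x ≤ if x ∈ U then 1 else 0 := by
      intro x _
      split_ifs with hxU
      · exact hc1 x
      · exact (hc0 x hxU).le
    have hs : ∑ x, c x = ∑ x, (if x ∈ U then (1 : ℝ) else 0) := by
      rw [hcs]
      simp [Finset.sum_boole, Set.ncard_eq_toFinset_card', Set.toFinset]
    have := (Finset.sum_eq_sum_iff_of_le hle).1 hs x (Finset.mem_univ x)
    simpa [hx] using this
  have ha : ∀ x ∈ S, a x = 1 := hsat S a
    (fun x => by linarith [h.cap_vertex x, hin x]) h.source_support hsum.symm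
  have hab : ∑ x, a x = ∑ x, b x := by
    have h1 : ∑ x, (a x + ∑ y, f y x) = ∑ x, ((∑ y, f x y) + b x) :=
      Finset.sum_congr rfl fun x _ => h.conserve x
    rw [Finset.sum_add_distrib, Finset.sum_add_distrib, Finset.sum_comm] at h1
    linarith
  have hb : ∀ x ∈ T, b x = 1 := hsat T b
    (fun x => by linarith [h.cap_vertex x, hout x, h.conserve x]) h.sink_support
    (by rw [← hab, ← hsum, hcard])
  have hinS : ∀ x y, y ∈ S → f x y = 0 := by
    intro x y hy
    have h1 : ∑ z, f z y = 0 := le_antisymm (by linarith [h.cap_vertex y, ha y hy]) (hin y)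
    exact (Finset.sum_eq_zero_iff_of_nonneg fun z _ => h.nonneg z y).1 h1 x (Finset.mem_univ x)
  have houtT : ∀ x y, x ∈ T → f x y = 0 := by
    intro x y hx
    have h1 : ∑ z, f x z = 0 :=
      le_antisymm (by linarith [h.cap_vertex x, hb x hx, h.conserve x]) (hout x)
    exact (Finset.sum_eq_zero_iff_of_nonneg fun z _ => h.nonneg x z).1 h1 y (Finset.mem_univ y)
  -- The unused capacity of each vertex is put on the diagonal, so that rows outside `T` and columns
  -- outside `S` sum to 1.
  let g : α → α → ℝ := fun x y => f x y + if x = y then 1 - (a x + ∑ z, f z x) else 0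
  have hgS : ∀ x y, x ∉ T → y ∈ S → g x y = 0 := by
    intro x y hx hy
    simp only [g, hinS x y hy, zero_add]
    split_ifs with hxy
    · subst hxy
      rw [ha x hy, Finset.sum_eq_zero fun z _ => hinS z x hy]
      norm_num
    · rfl
  have hgT : ∀ x y, x ∈ T → y ∉ S → g x y = 0 := by
    intro x y hx hy
    simp only [g, houtT x y hx, zero_add]
    split_ifs with hxy
    · subst hxy
      rw [h.conserve x, hb x hx, Finset.sum_eq_zero fun z _ => houtT x z hx]
      norm_num
    · rfl
  have hrow : ∀ x, x ∉ T → ∑ y : {y // y ∉ S}, g x y = 1 := by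
    intro x hx
    rw [sum_notMem_eq_sum fun y hy => hgS x y hx hy, Finset.sum_add_distrib, h.conserve x,
      h.sink_support x hx]
    simp
  have hcol : ∀ y, y ∉ S → ∑ x : {x // x ∉ T}, g x y = 1 := by
    intro y hy
    rw [sum_notMem_eq_sum fun x hx => hgT x y hx hy, Finset.sum_add_distrib,
      Finset.sum_ite_eq' Finset.univ y, h.source_support y hy]
    simp
  have hgnn : ∀ x y, 0 ≤ g x y := by
    intro x y
    simp only [g]
    split_ifs
    · linarith [h.nonneg x y, h.cap_vertex x]
    · linarith [h.nonneg x y]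
  let e : {x // x ∉ T} ≃ {y // y ∉ S} := Fintype.equivOfCardEq (card_notMem_eq hcard)
  have hM : (Matrix.of fun x y => g x (e y) : Matrix {x // x ∉ T} {x // x ∉ T} ℝ) ∈
      doublyStochastic ℝ {x // x ∉ T} := by
    rw [mem_doublyStochastic_iff_sum]
    refine ⟨fun x y => hgnn _ _, fun x => ?_, fun y => ?_⟩
    · simp only [Matrix.of_apply]
      rw [Equiv.sum_comp e fun y => g x y]
      exact hrow x x.2
    · exact hcol (e y) (e y).2
  -- Birkhoff's theorem: a permutation of positive weight meets only positive entries, so real flows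
  -- need no integrality theorem.
  obtain ⟨w, hw0, hw1, hwM⟩ := exists_eq_sum_perm_of_mem_doublyStochastic hM
  obtain ⟨σ, hσ⟩ : ∃ σ, 0 < w σ := by
    by_contra! hcon
    have : ∑ σ, w σ ≤ 0 := Finset.sum_nonpos fun σ _ => hcon σ
    linarith
  have hpos : ∀ x : {x // x ∉ T}, 0 < g x (e (σ x)) := by
    intro x
    have h1 := congrFun (congrFun hwM x) (σ x)
    rw [Matrix.of_apply, Matrix.sum_apply] at h1
    rw [← h1]
    refine lt_of_lt_of_le ?_ (Finset.single_le_sum (fun ρ _ => ?_) (Finset.mem_univ σ))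
    · simpa [Equiv.Perm.permMatrix, PEquiv.toMatrix_apply] using hσ
    · rw [Matrix.smul_apply, smul_eq_mul]
      refine mul_nonneg (hw0 ρ) ?_
      simp only [Equiv.Perm.permMatrix, PEquiv.toMatrix_apply]
      split_ifs <;> norm_num
  refine ⟨σ.trans e, fun x hx => ?_⟩
  by_contra hE
  have h1 := hpos x
  rw [Equiv.trans_apply] at hx hE
  simp [g, h.support _ _ hE, hx.symm] at h1

/-! ### Minors of inverse matrices -/

namespace Matrix

variable {n K : Type*} [Fintype n] [DecidableEq n] [Field K]

open Classical in
/-- If no nonzero vector vanishes on `S` and has its image vanish off `T`, then the Leibniz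
expansion of the complementary minor has a nonzero term. -/
theorem exists_equiv_of_forall_mulVec {M : Matrix n n K} {S T : Set n} (hcard : S.ncard = T.ncard)
    (hM : ∀ x : n → K, (∀ i ∈ S, x i = 0) → (∀ j ∉ T, (M *ᵥ x) j = 0) → x = 0) :
    ∃ τ : {x // x ∉ T} ≃ {y // y ∉ S}, ∀ x : {x // x ∉ T}, M x (τ x) ≠ 0 := by
  let e : {x // x ∉ T} ≃ {y // y ∉ S} := Fintype.equivOfCardEq (card_notMem_eq hcard)
  let A : Matrix {x // x ∉ T} {x // x ∉ T} K := of fun x y => M x (e y)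
  have hA : A.det ≠ 0 := by
    intro h0
    obtain ⟨z, hz, hAz⟩ := exists_mulVec_eq_zero_iff.2 h0
    -- A kernel vector of the complementary block, extended by zero on `S`, contradicts `hM`.
    let x : n → K := fun y => if h : y ∉ S then z (e.symm ⟨y, h⟩) else 0
    have hx : x = 0 := by
      refine hM x (fun i hi => by simp [x, hi]) fun j hj => ?_
      have h1 := congrFun hAz ⟨j, hj⟩
      refine Eq.trans ?_ h1
      simp only [mulVec, dotProduct]
      rw [← sum_notMem_eq_sum (U := S) fun y hy => by simp [x, hy], ← Equiv.sum_comp e]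
      refine Finset.sum_congr rfl fun i _ => ?_
      simp [x, A, (e i).2]
    apply hz
    funext i
    have := congrFun hx (e i)
    simpa [x, (e i).2] using this
  rw [det_apply] at hA
  obtain ⟨σ, _, hσ⟩ := Finset.exists_ne_zero_of_sum_ne_zero hA
  refine ⟨σ.symm.trans e, fun x => ?_⟩
  have h1 : ∏ i, A (σ i) i ≠ 0 := fun h0 => hσ (by rw [h0, smul_zero])
  have h2 := Finset.prod_ne_zero_iff.1 h1 (σ.symm x) (Finset.mem_univ _)
  simpa [A] using h2

theorem mulVec_inv_of_isUnit {M : Matrix n n K} (hM : IsUnit M) (y : n → K) :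
    M *ᵥ (M⁻¹ *ᵥ y) = y := by
  rw [mulVec_mulVec, mul_nonsing_inv _ ((isUnit_iff_isUnit_det M).1 hM), one_mulVec]

/-- A minor of the inverse is nonzero if no nonzero vector vanishes on its rows and has its image
vanish off its columns. -/
theorem det_inv_submatrix_ne_zero {k : Type*} [Fintype k] [DecidableEq k] {M : Matrix n n K}
    (hunit : IsUnit M) {s t : k → n} (ht : Function.Injective t)
    (hM : ∀ x : n → K, (∀ i, x (s i) = 0) → (∀ j ∉ Set.range t, (M *ᵥ x) j = 0) → x = 0) :
    (M⁻¹.submatrix s t).det ≠ 0 := by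
  intro h0
  obtain ⟨z, hz, hAz⟩ := exists_mulVec_eq_zero_iff.2 h0
  let y : n → K := Function.extend t z (0 : n → K)
  have hyt : ∀ i, y (t i) = z i := fun i => ht.extend_apply z 0 i
  have hy0 : ∀ j ∉ Set.range t, y j = 0 := fun j hj => Function.extend_apply' z (0 : n → K) j hj
  -- A kernel vector of the minor, extended by zero off the columns, has a preimage under `M` that
  -- vanishes on the rows.
  have hx : M⁻¹ *ᵥ y = 0 := by
    refine hM _ (fun i => ?_) fun j hj => ?_
    · refine Eq.trans ?_ (congrFun hAz i)
      simp only [mulVec, dotProduct, submatrix_apply]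
      rw [sum_eq_sum_of_injective ht (fun j hj => by rw [hy0 j hj, mul_zero])]
      simp [hyt]
    · rw [mulVec_inv_of_isUnit hunit, hy0 j hj]
  have hy : y = 0 := by rw [← mulVec_inv_of_isUnit hunit y, hx, mulVec_zero]
  apply hz
  funext i
  rw [← hyt, hy]
  rfl

end Matrix


/-! ### Nonzero minors from partial injections -/

namespace Matrix

variable {V : Type*} [Fintype V] [DecidableEq V]

open Classical in
/-- Weights along the edges of a partial injection, such that the minor of `(1 - Λ)⁻¹` on the
points where the injection is undefined and the points that it misses does not vanish. -/
theorem exists_det_one_sub_inv_submatrix_ne_zero {H : V → V → Prop} {k : Type*} [Fintype k]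
    [DecidableEq k] {c s : k → V} (hs : Function.Injective s) {σ : V → V}
    (hinj : Set.InjOn σ (Set.range c)ᶜ) (hmap : ∀ z ∉ Set.range c, σ z ∉ Set.range s)
    (hH : ∀ z ∉ Set.range c, σ z ≠ z → H (σ z) z) :
    ∃ Λ : Matrix V V ℝ, (∀ a b, Λ a b ≠ 0 → H a b) ∧ IsUnit (1 - Λ) ∧
      ((1 - Λ)⁻¹.submatrix c s).det ≠ 0 := by
  -- Weight 2 rather than 1 keeps `1 - Λ` invertible when `σ` has cycles: following `σ` doubles a
  -- coordinate, which is incompatible with extremal absolute values. Fixed points get weight 0,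
  -- since loops are excluded.
  let Λ : Matrix V V ℝ := of fun a z => if z ∉ Set.range c ∧ σ z = a ∧ a ≠ z then 2 else 0
  have hΛ1 : ∀ (x : V → ℝ) z, z ∉ Set.range c → σ z ≠ z → (Λ *ᵥ x) (σ z) = 2 * x z := by
    intro x z hz hne
    rw [mulVec, dotProduct, Finset.sum_eq_single z]
    · simp only [Λ, of_apply]
      rw [if_pos ⟨hz, trivial, hne⟩]
    · intro y _ hy
      simp only [Λ, of_apply]
      rw [if_neg fun h => hy (hinj h.1 hz h.2.1), zero_mul]
    · simp
  have hΛ0 : ∀ (x : V → ℝ) y, (∀ z ∉ Set.range c, σ z ≠ z → σ z ≠ y) → (Λ *ᵥ x) y = 0 := by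
    intro x y hy
    rw [mulVec, dotProduct]
    refine Finset.sum_eq_zero fun z _ => ?_
    simp only [Λ, of_apply]
    rw [if_neg, zero_mul]
    rintro ⟨h1, rfl, h3⟩
    exact hy z h1 h3 rfl
  have hunit : IsUnit (1 - Λ) := by
    rw [isUnit_iff_isUnit_det, isUnit_iff_ne_zero]
    intro h0
    obtain ⟨x, hx, hΛx⟩ := exists_mulVec_eq_zero_iff.2 h0
    rw [sub_mulVec, one_mulVec, sub_eq_zero] at hΛx
    obtain ⟨y₀, hy₀⟩ := Function.ne_iff.1 hx
    -- A kernel vector has a nonzero coordinate of least absolute value, but its predecessor under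
    -- `σ` would have half that value.
    obtain ⟨y, hy, hmin⟩ := Finset.exists_min_image (Finset.univ.filter fun y => x y ≠ 0)
      (fun y => |x y|) ⟨y₀, by simpa using hy₀⟩
    have hy : x y ≠ 0 := by simpa using hy
    by_cases h : ∃ z, z ∉ Set.range c ∧ σ z ≠ z ∧ σ z = y
    · obtain ⟨z, h1, h2, rfl⟩ := h
      have h3 : x (σ z) = 2 * x z := by rw [← hΛ1 x z h1 h2, ← hΛx]
      have h4 : x z ≠ 0 := fun h => hy (by rw [h3, h, mul_zero])
      have h5 := hmin z (by simpa using h4)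
      rw [h3, abs_mul, abs_two] at h5
      have := abs_pos.2 h4
      linarith
    · push Not at h
      exact hy (by rw [hΛx]; exact hΛ0 x y h)
  refine ⟨Λ, fun a b hab => ?_, hunit, det_inv_submatrix_ne_zero hunit hs fun x hx0 hx => ?_⟩
  · simp only [Λ, of_apply] at hab
    split_ifs at hab with h
    · obtain ⟨h1, rfl, h3⟩ := h
      exact hH b h1 h3
    · exact absurd rfl hab
  · rcases isEmpty_or_nonempty V with hV | hV
    · exact Subsingleton.elim _ _
    -- At a coordinate of largest absolute value outside `range c`, the row `σ z` would force the
    -- double at `σ z`, so the maximum is 0.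
    obtain ⟨z, -, hmax⟩ := Finset.exists_max_image Finset.univ (fun y => |x y|) Finset.univ_nonempty
    have hz : x z = 0 := by
      by_cases hzc : z ∈ Set.range c
      · obtain ⟨i, rfl⟩ := hzc
        exact hx0 i
      · have h1 := hx (σ z) (hmap z hzc)
        rw [sub_mulVec, one_mulVec, Pi.sub_apply, sub_eq_zero] at h1
        by_cases hf : σ z = z
        · rw [hf, hΛ0 x z fun z' h2 h3 h4 => h3 ?_] at h1
          · exact h1
          · rw [hinj h2 hzc (h4.trans hf.symm), hf]
        · rw [hΛ1 x z hzc hf] at h1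
          have h2 := hmax (σ z) (Finset.mem_univ _)
          rw [h1, abs_mul, abs_two] at h2
          exact abs_eq_zero.1 (le_antisymm (by linarith) (abs_nonneg _))
    funext y
    have := hmax y (Finset.mem_univ y)
    rw [hz, abs_zero] at this
    exact abs_eq_zero.1 (le_antisymm this (abs_nonneg _))

end Matrix

/-! ### Splitting a bijection at the passage between the two copies -/

namespace MixedGraph

variable {V : Type*} (G : MixedGraph V)

open Classical in
/-- A bijection along the edges of the flow graph splits into a part on each copy of the vertex
set and the pairs `(c i, d i)` at which it passes from the first copy to the second. -/
theorem exists_crossings [Fintype V] {S T : Set V} {k : ℕ} (hS : S.ncard = k)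
    (τ : {x // x ∉ (Sum.inr '' T : Set (V ⊕ V))} ≃ {y // y ∉ (Sum.inl '' S : Set (V ⊕ V))})
    (hτ : ∀ x, (τ x : V ⊕ V) ≠ x → G.flowGraph x (τ x)) :
    ∃ (c d : Fin k → V) (p q : V → V), (∀ i, c i = d i ∨ G.bi (c i) (d i)) ∧
      Set.InjOn p (Set.range c)ᶜ ∧ (∀ z ∉ Set.range c, p z ∉ S) ∧
      (∀ z ∉ Set.range c, p z ≠ z → G.dir (p z) z) ∧
      Set.InjOn q (Set.range d)ᶜ ∧ (∀ z ∉ Set.range d, q z ∉ T) ∧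
      (∀ z ∉ Set.range d, q z ≠ z → G.dir (q z) z) := by
  let l : V → V ⊕ V := fun i => τ ⟨Sum.inl i, by simp⟩
  let r : V → V ⊕ V := fun j => τ.symm ⟨Sum.inr j, by simp⟩
  have hl : Function.Injective l := fun i j h => by
    simpa using τ.injective (Subtype.ext h)
  have hr : Function.Injective r := fun i j h => by
    simpa using τ.symm.injective (Subtype.ext h)
  have hlS : ∀ i, l i ∉ (Sum.inl '' S : Set (V ⊕ V)) := fun i => (τ _).2
  have hrT : ∀ i, r i ∉ (Sum.inr '' T : Set (V ⊕ V)) := fun i => (τ.symm _).2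
  have hlE : ∀ i, l i ≠ Sum.inl i → G.flowGraph (Sum.inl i) (l i) := fun i h => hτ _ h
  have hrE : ∀ j, r j ≠ Sum.inr j → G.flowGraph (r j) (Sum.inr j) := fun j h => by
    have := hτ (τ.symm ⟨Sum.inr j, by simp⟩)
    rw [Equiv.apply_symm_apply] at this
    exact this h.symm
  have hlr : ∀ i j, r j = Sum.inl i → l i = Sum.inr j := fun i j h => by
    have h1 : (⟨Sum.inl i, by simp⟩ : {x // x ∉ (Sum.inr '' T : Set (V ⊕ V))}) =
        τ.symm ⟨Sum.inr j, by simp⟩ := Subtype.ext h.symm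
    simp only [l, h1, Equiv.apply_symm_apply]
  -- No edge leads from the second copy back to the first, so these points are reached from the
  -- first copy only.
  have hsurj : ∀ y ∉ S, ∃ i, l i = Sum.inl y := fun y hy => by
    have hy' : (Sum.inl y : V ⊕ V) ∉ (Sum.inl '' S : Set (V ⊕ V)) := by simpa using hy
    obtain ⟨⟨x, hx⟩, hxy⟩ := τ.surjective ⟨Sum.inl y, hy'⟩
    rcases x with i | i
    · exact ⟨i, congrArg Subtype.val hxy⟩
    · have := hτ ⟨Sum.inr i, hx⟩
      rw [hxy] at this
      exact (this (by simp)).elim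
  let p : V → V := fun i => (l i).elim id id
  let q : V → V := fun i => (r i).elim id id
  let C : Finset V := Finset.univ.filter fun i => ∃ j, l i = Sum.inr j
  have hpC : ∀ z ∉ C, l z = Sum.inl (p z) := fun z hz => by
    rcases h : l z with i | j
    · simp [p, h]
    · exact absurd (by simpa [C] using ⟨j, h⟩) hz
  have hpinj : Set.InjOn p (Cᶜ : Finset V) := fun x hx y hy hxy => hl <| by
    rw [hpC x (by simpa using hx), hpC y (by simpa using hy), hxy]
  have hpS : ∀ z ∉ C, p z ∉ S := fun z hz h => hlS z ⟨p z, h, (hpC z hz).symm⟩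
  -- Off the crossing set `C`, `p` is a bijection onto the complement of `S`; hence `C` and `S` have
  -- the same size.
  have hcard : C.card = k := by
    have h1 : Finset.image p Cᶜ = (Finset.univ.filter fun i => i ∈ S)ᶜ := by
      ext y
      simp only [Finset.mem_image, Finset.mem_compl, Finset.mem_filter, Finset.mem_univ, true_and]
      constructor
      · rintro ⟨z, hz, rfl⟩
        exact hpS z hz
      · intro hy
        obtain ⟨i, hi⟩ := hsurj y hy
        exact ⟨i, by simp [C, hi], by simp [p, hi]⟩
    have h2 := congrArg Finset.card h1
    rw [Finset.card_image_of_injOn hpinj, Finset.card_compl, Finset.card_compl] at h2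
    have h3 : (Finset.univ.filter fun i => i ∈ S).card = k := by
      rw [← hS, Set.ncard_eq_toFinset_card', Set.toFinset]
      congr 1
      ext
      simp
    have h4 := Finset.card_le_univ C
    have h5 := Finset.card_le_univ (Finset.univ.filter fun i => i ∈ S)
    omega
  let e := C.equivFinOfCardEq hcard
  let c : Fin k → V := fun i => e.symm i
  have hc : ∀ z, z ∈ Set.range c ↔ z ∈ C := fun z => by
    constructor
    · rintro ⟨i, rfl⟩
      exact (e.symm i).2
    · exact fun hz => ⟨e ⟨z, hz⟩, by simp [c]⟩
  have hcd : ∀ z ∈ C, l z = Sum.inr (p z) := fun z hz => by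
    obtain ⟨j, hj⟩ : ∃ j, l z = Sum.inr j := by simpa [C] using hz
    simp [p, hj]
  have hqd : ∀ z ∉ Set.range (p ∘ c), r z = Sum.inr (q z) := fun z hz => by
    rcases h : r z with i | j
    · have h1 := hlr i z h
      have h2 : i ∈ C := by simp [C, h1]
      obtain ⟨k, hk⟩ := (hc i).2 h2
      exact absurd ⟨k, by simp [hk, p, h1]⟩ hz
    · simp [q, h]
  refine ⟨c, p ∘ c, p, q, fun i => ?_, ?_, fun z hz => hpS z (by rwa [hc] at hz),
    fun z hz hne => ?_, ?_, fun z hz h => hrT z ⟨q z, h, (hqd z hz).symm⟩, fun z hz hne => ?_⟩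
  · have h1 := hcd (c i) ((hc _).1 ⟨i, rfl⟩)
    have h2 := hlE (c i) (by rw [h1]; simp)
    rw [h1] at h2
    exact h2
  · intro x hx y hy
    rw [Set.mem_compl_iff, hc] at hx hy
    exact hpinj (by simpa using hx) (by simpa using hy)
  · rw [hc] at hz
    have h2 := hlE z (by rw [hpC z hz]; simpa using hne)
    rw [hpC z hz] at h2
    exact h2
  · intro x hx y hy hxy
    exact hr (by rw [hqd x hx, hqd y hy, hxy])
  · have h2 := hrE z (by rw [hqd z hz]; simpa using hne)
    rw [hqd z hz] at h2
    exact h2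

end MixedGraph


/-! ### Interpolation between two choices of parameters -/

namespace Matrix

variable {V : Type*} [Fintype V] [DecidableEq V]

theorem adjugate_eq_det_smul_inv_of_isUnit {K : Type*} [Field K] {M : Matrix V V K}
    (hM : IsUnit M) : M.adjugate = M.det • M⁻¹ := by
  have h : M.det ≠ 0 := ((isUnit_iff_isUnit_det M).1 hM).ne_zero
  rw [inv_def, Ring.inverse_eq_inv', smul_smul, mul_inv_cancel₀ h, one_smul]

theorem map_det_mul_adjugate_submatrix {R R' k : Type*} [CommRing R] [CommRing R'] [Fintype k]
    [DecidableEq k] (f : R →+* R') (A : Matrix k V R) (M : Matrix V V R) (s : k → V) :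
    f ((A * M.adjugate).submatrix id s).det =
      ((A.map f * (M.map f).adjugate).submatrix id s).det := by
  rw [RingHom.map_det, RingHom.mapMatrix_apply, ← submatrix_map, Matrix.map_mul,
    ← RingHom.mapMatrix_apply f M.adjugate, RingHom.map_adjugate, RingHom.mapMatrix_apply]

/-- If one of two minors does not vanish at the first end of a segment and the other one does not
vanish at its second end, then neither vanishes at some point in between. -/
theorem exists_det_mul_inv_submatrix_ne_zero {k : Type*} [Fintype k] [DecidableEq k]
    {Λ₁ Λ₂ : Matrix V V ℝ} {L₁ L₂ : Matrix k V ℝ} {s t : k → V}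
    (h₁ : IsUnit (1 - Λ₁)) (h₂ : IsUnit (1 - Λ₂))
    (hs : ((L₁ * (1 - Λ₁)⁻¹).submatrix id s).det ≠ 0)
    (ht : ((L₂ * (1 - Λ₂)⁻¹).submatrix id t).det ≠ 0) :
    ∃ r : ℝ, IsUnit (1 - (Λ₁ + r • (Λ₂ - Λ₁))) ∧
      (((L₁ + r • (L₂ - L₁)) * (1 - (Λ₁ + r • (Λ₂ - Λ₁)))⁻¹).submatrix id s).det ≠ 0 ∧
      (((L₁ + r • (L₂ - L₁)) * (1 - (Λ₁ + r • (Λ₂ - Λ₁)))⁻¹).submatrix id t).det ≠ 0 := by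
  let M : Matrix V V (Polynomial ℝ) :=
    1 - (Λ₁.map Polynomial.C + (Polynomial.X : Polynomial ℝ) • (Λ₂ - Λ₁).map Polynomial.C)
  let A : Matrix k V (Polynomial ℝ) :=
    L₁.map Polynomial.C + (Polynomial.X : Polynomial ℝ) • (L₂ - L₁).map Polynomial.C
  have hM : ∀ r, M.map (Polynomial.evalRingHom r) = 1 - (Λ₁ + r • (Λ₂ - Λ₁)) := by
    intro r
    ext i j
    by_cases hij : i = j <;> simp [M, hij]
  have hA : ∀ r, A.map (Polynomial.evalRingHom r) = L₁ + r • (L₂ - L₁) := by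
    intro r
    ext i j
    simp [A]
  have hdet : ∀ r, M.det.eval r = (1 - (Λ₁ + r • (Λ₂ - Λ₁))).det := by
    intro r
    rw [← hM, ← Polynomial.coe_evalRingHom, RingHom.map_det, RingHom.mapMatrix_apply]
  -- Replacing the inverse by the adjugate clears denominators, at the price of one determinant
  -- factor per row of the minor.
  have hsub : ∀ r (u : k → V), IsUnit (1 - (Λ₁ + r • (Λ₂ - Λ₁))) →
      ((A * M.adjugate).submatrix id u).det.eval r =
      (1 - (Λ₁ + r • (Λ₂ - Λ₁))).det ^ Fintype.card k *
      (((L₁ + r • (L₂ - L₁)) * (1 - (Λ₁ + r • (Λ₂ - Λ₁)))⁻¹).submatrix id u).det := by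
    intro r u hr
    rw [← Polynomial.coe_evalRingHom, map_det_mul_adjugate_submatrix, hM, hA,
      adjugate_eq_det_smul_inv_of_isUnit hr, Matrix.mul_smul, submatrix_smul, Pi.smul_apply,
      Pi.smul_apply, det_smul]
  have hu : ∀ {N : Matrix V V ℝ}, IsUnit N → N.det ≠ 0 := fun h =>
    ((isUnit_iff_isUnit_det _).1 h).ne_zero
  have e₁ : Λ₁ + (0 : ℝ) • (Λ₂ - Λ₁) = Λ₁ := by simp
  have e₂ : Λ₁ + (1 : ℝ) • (Λ₂ - Λ₁) = Λ₂ := by simp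
  have f₁ : L₁ + (0 : ℝ) • (L₂ - L₁) = L₁ := by simp
  have f₂ : L₁ + (1 : ℝ) • (L₂ - L₁) = L₂ := by simp
  have hM0 : M.det ≠ 0 := fun h => hu h₁ (by rw [← e₁, ← hdet, h, Polynomial.eval_zero])
  have hs0 : ((A * M.adjugate).submatrix id s).det ≠ 0 := fun h => by
    have := hsub 0 s (by rwa [e₁])
    rw [h, Polynomial.eval_zero, e₁, f₁] at this
    exact mul_ne_zero (pow_ne_zero _ (hu h₁)) hs this.symm
  have ht0 : ((A * M.adjugate).submatrix id t).det ≠ 0 := fun h => by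
    have := hsub 1 t (by rwa [e₂])
    rw [h, Polynomial.eval_zero, e₂, f₂] at this
    exact mul_ne_zero (pow_ne_zero _ (hu h₂)) ht this.symm
  -- The product of three nonzero polynomials in `r` is nonzero at some real number.
  obtain ⟨r, hr⟩ := Polynomial.exists_eval_ne_zero_of_natDegree_lt_card _
    (mul_ne_zero hM0 (mul_ne_zero hs0 ht0)) (Cardinal.natCast_lt_aleph0 |>.trans_le
      (Cardinal.aleph0_le_mk ℝ))
  rw [Polynomial.eval_mul, Polynomial.eval_mul] at hr
  have hr1 := left_ne_zero_of_mul hr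
  have hr2 := left_ne_zero_of_mul (right_ne_zero_of_mul hr)
  have hr3 := right_ne_zero_of_mul (right_ne_zero_of_mul hr)
  have hunit : IsUnit (1 - (Λ₁ + r • (Λ₂ - Λ₁))) := by
    rw [isUnit_iff_isUnit_det, isUnit_iff_ne_zero, ← hdet]
    exact hr1
  rw [hsub r _ hunit] at hr2 hr3
  exact ⟨r, hunit, right_ne_zero_of_mul hr2, right_ne_zero_of_mul hr3⟩

end Matrix

/-! ### A nonzero covariance minor from a saturating flow -/

namespace MixedGraph

open Matrix

variable {V : Type*} (G : MixedGraph V) [Fintype V] [DecidableEq V]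

/-- The covariance matrix with error covariance `ε + Lᵀ L`, where the rows of `L` are supported on
bidirected edges or on single vertices, has a nonzero minor if the two corresponding minors of
`L (1 - Λ)⁻¹` are nonzero and `ε > 0` is small. -/
theorem exists_mem_paramSpace_det_ne_zero {k : Type*} [Fintype k] [DecidableEq k]
    {Λ : Matrix V V ℝ} (hΛ : ∀ a b, Λ a b ≠ 0 → G.dir a b) (hunit : IsUnit (1 - Λ))
    {L : Matrix k V ℝ} (hL : ∀ i a b, a ≠ b → L i a ≠ 0 → L i b ≠ 0 → G.bi a b) {s t : k → V}
    (hs : ((L * (1 - Λ)⁻¹).submatrix id s).det ≠ 0)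
    (ht : ((L * (1 - Λ)⁻¹).submatrix id t).det ≠ 0) :
    ∃ θ ∈ G.paramSpace, ((covariance θ).submatrix s t).det ≠ 0 := by
  let P := (1 - Λ)⁻¹
  let F : ℝ → ℝ := fun ε => ((Pᵀ * (ε • (1 : Matrix V V ℝ) + Lᵀ * L) * P).submatrix s t).det
  have hF : Continuous F := by
    refine Continuous.matrix_det (Continuous.matrix_submatrix ?_ _ _)
    fun_prop
  have hF0 : F 0 ≠ 0 := by
    -- At `ε = 0` the minor factors through the index set `k` of the rows of `L`, so it is a product
    -- of two square determinants. A small positive `ε` then restores positive definiteness.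
    have h1 : (Pᵀ * ((0 : ℝ) • (1 : Matrix V V ℝ) + Lᵀ * L) * P).submatrix s t =
        ((L * P).submatrix id s)ᵀ * (L * P).submatrix id t := by
      rw [zero_smul, zero_add, transpose_submatrix, ← submatrix_mul _ _ _ _ _ Function.bijective_id,
        transpose_mul]
      simp only [Matrix.mul_assoc]
    simp only [F]
    rw [h1, det_mul, det_transpose]
    exact mul_ne_zero hs ht
  have hev : ∀ᶠ ε in nhdsWithin (0 : ℝ) (Set.Ioi 0), F ε ≠ 0 :=
    (hF.continuousAt.eventually_ne hF0).filter_mono nhdsWithin_le_nhds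
  obtain ⟨ε, hε, hε0⟩ := (hev.and self_mem_nhdsWithin).exists
  refine ⟨(Λ, ε • 1 + Lᵀ * L), ⟨hΛ, hunit, ?_, fun a b hab h => ?_⟩, hε⟩
  · refine PosDef.add_posSemidef (PosDef.one.smul hε0) ?_
    have := posSemidef_conjTranspose_mul_self L
    rwa [conjTranspose_eq_transpose_of_trivial] at this
  · have h1 : ∑ i, L i a * L i b ≠ 0 := by
      simpa [Matrix.one_apply, hab, Matrix.mul_apply] using h
    obtain ⟨i, _, hi⟩ := Finset.exists_ne_zero_of_sum_ne_zero h1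
    exact hL i a b hab (left_ne_zero_of_mul hi) (right_ne_zero_of_mul hi)

/-- A saturating flow in the flow graph forces the corresponding minor of the covariance matrix to
be nonzero somewhere on the parameter space. -/
theorem exists_det_covariance_ne_zero_of_maxFlow {k : ℕ} {s t : Fin k → V}
    (hs : Function.Injective s) (ht : Function.Injective t)
    (hflow : maxFlow G.flowGraph (Sum.inl '' Set.range s) (Sum.inr '' Set.range t) = (k : ℝ)) :
    ∃ θ ∈ G.paramSpace, ((covariance θ).submatrix s t).det ≠ 0 := by
  have hks : (Set.range s).ncard = k := by
    rw [← Set.image_univ, Set.ncard_image_of_injective _ hs, Set.ncard_univ, Nat.card_fin]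
  have hkt : (Set.range t).ncard = k := by
    rw [← Set.image_univ, Set.ncard_image_of_injective _ ht, Set.ncard_univ, Nat.card_fin]
  have hks' : (Sum.inl '' Set.range s : Set (V ⊕ V)).ncard = k := by
    rw [Set.ncard_image_of_injective _ Sum.inl_injective, hks]
  have hkt' : (Sum.inr '' Set.range t : Set (V ⊕ V)).ncard = k := by
    rw [Set.ncard_image_of_injective _ Sum.inr_injective, hkt]
  have hmem := (isGreatest_maxFlow G.flowGraph (Sum.inl '' Set.range s) (Sum.inr '' Set.range t)).1
  rw [hflow] at hmem
  obtain ⟨τ, hτ⟩ := exists_equiv_of_ncard_mem_unitFlowValues (hks'.trans hkt'.symm)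
    (by rwa [hks'])
  obtain ⟨c, d, p, q, hcd, hp, hpS, hpG, hq, hqT, hqG⟩ := G.exists_crossings hks τ hτ
  obtain ⟨Λ₁, hΛ₁, hu₁, hd₁⟩ := exists_det_one_sub_inv_submatrix_ne_zero hs hp hpS hpG
  obtain ⟨Λ₂, hΛ₂, hu₂, hd₂⟩ := exists_det_one_sub_inv_submatrix_ne_zero ht hq hqT hqG
  have hsub : ∀ (e : Fin k → V) (M : Matrix V V ℝ) (u : Fin k → V),
      ((1 : Matrix V V ℝ).submatrix e id * M).submatrix id u = M.submatrix e u := by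
    intro e M u
    ext i j
    simp [Matrix.mul_apply, Matrix.one_apply]
  obtain ⟨r, hr, hrs, hrt⟩ := exists_det_mul_inv_submatrix_ne_zero hu₁ hu₂
    (L₁ := (1 : Matrix V V ℝ).submatrix c id) (L₂ := (1 : Matrix V V ℝ).submatrix d id)
    (by rwa [hsub]) (by rwa [hsub])
  refine G.exists_mem_paramSpace_det_ne_zero (fun a b h => ?_) hr (fun i a b hab h1 h2 => ?_)
    hrs hrt
  · by_contra hG
    have h1 : Λ₁ a b = 0 := by_contra fun h => hG (hΛ₁ a b h)
    have h2 : Λ₂ a b = 0 := by_contra fun h => hG (hΛ₂ a b h)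
    simp [h1, h2] at h
  -- Row `i` of the interpolated `L` lives on `c i` and `d i` only, which are equal or joined by a
  -- bidirected edge.
  · have key : ∀ a, ((1 : Matrix V V ℝ).submatrix c id + r • ((1 : Matrix V V ℝ).submatrix d id -
        (1 : Matrix V V ℝ).submatrix c id)) i a ≠ 0 → a = c i ∨ a = d i := by
      intro a h
      by_contra! hcon
      simp [hcon.1.symm, hcon.2.symm] at h
    rcases key a h1 with rfl | rfl <;> rcases key b h2 with rfl | rfl
    · exact absurd rfl hab
    · exact (hcd i).resolve_left hab
    · exact G.bi_symm _ _ ((hcd i).resolve_left hab.symm)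
    · exact absurd rfl hab

end MixedGraph


/-! ### Extended subdeterminants -/

-- The auxiliary column `z` is arbitrary, as Cramer's map overwrites it. This form makes linearity
-- in the last column available.
open Matrix in
theorem extSubdet_eq_cramer {V R : Type*} [CommRing R] {m : ℕ} (M : Matrix V V R)
    (s : Fin (m + 1) → V) (t : Fin m → V) (z x : V) :
    extSubdet M s t x =
      cramer (M.submatrix s (Fin.snoc t z : Fin (m + 1) → V)) (fun i => M (s i) x) (Fin.last m) := by
  rw [cramer_apply, extSubdet]
  congr 1
  ext i j
  refine Fin.lastCases ?_ (fun j => ?_) j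
  · simp
  · rw [updateCol_ne (Fin.castSucc_lt_last j).ne]
    simp

open Matrix in
theorem sum_mul_extSubdet {V R : Type*} [Fintype V] [CommRing R] {m : ℕ} (M : Matrix V V R)
    (s : Fin (m + 1) → V) (t : Fin m → V) (z : V) (u : V → R) :
    ∑ a, u a * extSubdet M s t a =
      cramer (M.submatrix s (Fin.snoc t z : Fin (m + 1) → V)) (fun i => (M *ᵥ u) (s i))
        (Fin.last m) := by
  have h : (fun i => (M *ᵥ u) (s i)) = ∑ a, u a • fun i => M (s i) a := by
    funext i
    simp [mulVec, dotProduct, mul_comm]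
  rw [h, map_sum, Finset.sum_apply]
  refine Finset.sum_congr rfl fun a _ => ?_
  rw [map_smul, Pi.smul_apply, smul_eq_mul, ← extSubdet_eq_cramer]

/-! ### The determinantal relation forced by a missing flow -/

namespace MixedGraph

open Matrix

variable {V : Type*} (G : MixedGraph V) [Fintype V] [DecidableEq V]

open Classical in
/-- The equations of `1 - Λ` at the descendants of `v` form a nonsingular system in the
coordinates at the descendants of `v`. -/
theorem eq_zero_of_mem_des {Λ : Matrix V V ℝ} (hΛ : ∀ a b, Λ a b ≠ 0 → G.dir a b)
    (hunit : IsUnit (1 - Λ)) {v : V} {x : V → ℝ} (hx : ∀ a ∈ G.des v, ((1 - Λ) *ᵥ x) a = 0) :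
    ∀ a ∈ G.des v, x a = 0 := by
  -- Descendants are closed under directed edges, so `1 - Λ` is block triangular and its block on
  -- them inherits a nonzero determinant.
  have htri : ∀ i, i ∈ G.des v → ∀ j, ¬ j ∈ G.des v → (1 - Λ) i j = 0 := by
    intro i hi j hj
    have hij : i ≠ j := fun h => hj (h ▸ hi)
    have h0 : Λ i j = 0 := by_contra fun h => hj (hi.tail (hΛ i j h))
    simp [hij, h0]
  have hdet := ((isUnit_iff_isUnit_det _).1 hunit).ne_zero
  rw [twoBlockTriangular_det' (1 - Λ) (fun i => i ∈ G.des v) htri] at hdet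
  have h1 := eq_zero_of_mulVec_eq_zero (left_ne_zero_of_mul hdet)
    (v := fun i : {i // i ∈ G.des v} => x i) (by
      funext i
      refine Eq.trans ?_ (hx i i.2)
      simp only [mulVec, dotProduct, toSquareBlockProp]
      refine (sum_eq_sum_of_injective (F := fun j => (1 - Λ) i j * x j)
        Subtype.val_injective fun j hj => ?_).symm
      rw [htri i i.2 j (by simpa using hj), zero_mul])
  exact fun a ha => congrFun h1 ⟨a, ha⟩

open Classical in
/-- If the flow graph without the edges `u' → v'`, `u ∈ W`, carries no saturating flow, then the
determinant in the column `v` is the combination of those in the columns `u ∈ W`. -/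
theorem extSubdet_eq_sum_of_maxFlow_lt {v : V} {W : Set V} {m : ℕ} {s : Fin (m + 1) → V}
    {t : Fin m → V} (hs : Function.Injective s) (ht : Function.Injective t)
    (hvT : v ∉ Set.range t) (hW : ∀ a ∈ W, G.dir a v)
    (hdes : ∀ a ∈ G.des v, a ≠ v ∧ a ∉ Set.range t)
    (hflow : maxFlow (G.flowGraphDelete W v) (Sum.inl '' Set.range s)
      (Sum.inr '' (Set.range t ∪ {v})) < ((m + 1 : ℕ) : ℝ))
    {θ : ParamPair V} (hθ : θ ∈ G.paramSpace) :
    extSubdet (covariance θ) s t v =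
      ∑ a, (if a ∈ W then θ.1 a v else 0) * extSubdet (covariance θ) s t a := by
  obtain ⟨hΛ, hunit, -, hΩ⟩ := hθ
  set Λ := θ.1
  set Ω := θ.2
  let u : V → ℝ := fun a => if a ∈ W then Λ a v else 0
  let Λs : Matrix V V ℝ := of fun a b => if a ∈ W ∧ b = v then 0 else Λ a b
  let tv : Fin (m + 1) → V := Fin.snoc t v
  have htv : Function.Injective tv := Fin.snoc_injective_iff.2 ⟨ht, hvT⟩
  have hrange : Set.range tv = Set.range t ∪ {v} := by
    rw [Fin.range_snoc, Set.union_singleton]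
  have hΛΛs : ∀ x : V → ℝ, Λ *ᵥ x = Λs *ᵥ x + x v • u := by
    intro x
    funext a
    have : (x v • u) a = ∑ b, if b = v then u a * x b else 0 := by simp [mul_comm]
    rw [Pi.add_apply, this]
    simp only [mulVec, dotProduct]
    rw [← Finset.sum_add_distrib]
    refine Finset.sum_congr rfl fun b _ => ?_
    by_cases hb : b = v <;> by_cases ha : a ∈ W <;> simp [Λs, u, hb, ha]
  by_contra hne
  let A := (covariance θ).submatrix s tv
  -- The last column is Σ(e_v − u), so `B.det` is the difference of the two sides.
  let B := A.updateCol (Fin.last m) fun i => covariance θ (s i) v - (covariance θ *ᵥ u) (s i)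
  have hB : B.det ≠ 0 := by
    have h1 : B.det = extSubdet (covariance θ) s t v - ∑ a, u a * extSubdet (covariance θ) s t a := by
      rw [extSubdet_eq_cramer _ s t v v, sum_mul_extSubdet _ s t v, ← Pi.sub_apply, ← map_sub,
        cramer_apply]
      rfl
    rw [h1]
    exact sub_ne_zero.2 hne
  -- Off the diagonal, nonzero entries occur only at edges of the reduced flow graph: `Λs` drops
  -- exactly the coefficients of the deleted edges. Arguing with vectors avoids having to invert `1
  -- - Λs`.
  let M : Matrix (V ⊕ V) (V ⊕ V) ℝ := fromBlocks (1 - Λ)ᵀ (-Ω) 0 (1 - Λs)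
  have hcardS : (Sum.inl '' Set.range s : Set (V ⊕ V)).ncard = m + 1 := by
    rw [Set.ncard_image_of_injective _ Sum.inl_injective, ← Set.image_univ,
      Set.ncard_image_of_injective _ hs, Set.ncard_univ, Nat.card_fin]
  have hcardT : (Sum.inr '' Set.range tv : Set (V ⊕ V)).ncard = m + 1 := by
    rw [Set.ncard_image_of_injective _ Sum.inr_injective, ← Set.image_univ,
      Set.ncard_image_of_injective _ htv, Set.ncard_univ, Nat.card_fin]
  obtain ⟨τ, hτ⟩ := exists_equiv_of_forall_mulVec (M := M) (hcardS.trans hcardT.symm) (by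
    intro x hxS hxT
    let x₁ : V → ℝ := x ∘ Sum.inl
    let x₂ : V → ℝ := x ∘ Sum.inr
    let y : V → ℝ := (1 - Λs) *ᵥ x₂
    have hMx : M *ᵥ x = Sum.elim ((1 - Λ)ᵀ *ᵥ x₁ + -Ω *ᵥ x₂) (0 *ᵥ x₁ + y) :=
      fromBlocks_mulVec _ _ _ _ _
    have h1 : (1 - Λ)ᵀ *ᵥ x₁ = Ω *ᵥ x₂ := by
      funext i
      have := hxT (Sum.inl i) (by simp)
      rw [hMx, Sum.elim_inl, neg_mulVec, Pi.add_apply, Pi.neg_apply] at this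
      linarith
    have hy : ∀ j ∉ Set.range tv, y j = 0 := by
      intro j hj
      have := hxT (Sum.inr j) (by simpa using hj)
      rwa [hMx, Sum.elim_inr, zero_mulVec, zero_add] at this
    have h2 : (1 - Λ) *ᵥ x₂ = y - x₂ v • u := by
      simp only [y]
      rw [sub_mulVec, sub_mulVec, hΛΛs]
      abel
    -- Here (a) enters: on descendants of `v` both `y` and `u` vanish, since a member of `W` below
    -- `v` would close a cycle through `v`.
    have hdesx : ∀ a ∈ G.des v, x₂ a = 0 := by
      refine G.eq_zero_of_mem_des hΛ hunit fun a ha => ?_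
      have hu : u a = 0 := by
        simp only [u]
        rw [if_neg fun haW => ?_]
        exact (hdes v (ha.tail (hW a haW))).1 rfl
      rw [h2, Pi.sub_apply, Pi.smul_apply, hu, smul_zero, sub_zero]
      refine hy a ?_
      rw [hrange]
      rintro (h | h)
      · exact (hdes a ha).2 h
      · exact (hdes a ha).1 h
    have hv : x₂ v = y v := by
      have h3 : (Λs *ᵥ x₂) v = 0 := by
        refine Finset.sum_eq_zero fun b _ => ?_
        by_cases hb : Λ v b = 0
        · simp [Λs, hb]
        · rw [hdesx b (Relation.TransGen.single (hΛ v b hb)), mul_zero]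
      simp only [y]
      rw [sub_mulVec, one_mulVec, Pi.sub_apply, h3, sub_zero]
    rw [hv] at h2
    have hdet := (isUnit_iff_isUnit_det _).1 hunit
    have h3 : x₂ = (1 - Λ)⁻¹ *ᵥ (y - y v • u) := by
      rw [← h2, mulVec_mulVec, nonsing_inv_mul _ hdet, one_mulVec]
    have h4 : x₁ = covariance θ *ᵥ (y - y v • u) := by
      rw [covariance, ← mulVec_mulVec, ← h3, ← mulVec_mulVec, ← h1, mulVec_mulVec,
        ← transpose_mul, mul_nonsing_inv _ hdet, transpose_one, one_mulVec]
    -- As `x₁` is Σ(y − y_v u) and vanishes on `s`, the coordinates of `y` on `T ∪ {v}` form a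
    -- kernel vector of `B`.
    have h5 : (fun k => y (tv k)) = 0 := by
      refine eq_zero_of_mulVec_eq_zero hB ?_
      funext i
      have h6 : x₁ (s i) = 0 := hxS _ ⟨s i, ⟨i, rfl⟩, rfl⟩
      have h7 : (covariance θ *ᵥ y) (s i) = ∑ k, covariance θ (s i) (tv k) * y (tv k) :=
        sum_eq_sum_of_injective htv fun j hj => by rw [hy j hj, mul_zero]
      rw [h4, mulVec_sub, mulVec_smul, Pi.sub_apply, Pi.smul_apply, h7, smul_eq_mul,
        Fin.sum_univ_castSucc] at h6
      simp only [mulVec, dotProduct]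
      rw [Fin.sum_univ_castSucc, Pi.zero_apply, ← h6]
      have h8 : ∀ k : Fin m, B i k.castSucc = covariance θ (s i) (tv k.castSucc) := fun k => by
        simp only [B]
        rw [updateCol_ne (Fin.castSucc_lt_last k).ne]
        rfl
      have h9 : tv (Fin.last m) = v := by simp [tv]
      simp only [h8, h9]
      simp only [B, updateCol_self]
      simp only [mulVec, dotProduct]
      ring
    have hy0 : y = 0 := by
      funext j
      by_cases hj : j ∈ Set.range tv
      · obtain ⟨k, rfl⟩ := hj
        exact congrFun h5 k
      · exact hy j hj
    have hx₂ : x₂ = 0 := by rw [h3, hy0]; simp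
    have hx₁ : x₁ = 0 := by rw [h4, hy0]; simp
    funext i
    rcases i with i | i
    · exact congrFun hx₁ i
    · exact congrFun hx₂ i)
  have hmem := ncard_mem_unitFlowValues_of_equiv (E := G.flowGraphDelete W v) τ (by
    intro x hx
    have hM := hτ x
    generalize (τ x : V ⊕ V) = z at hx hM
    generalize (x : V ⊕ V) = x at hx hM
    rcases x with i | i <;> rcases z with j | j
    · have hij : j ≠ i := fun h => hx (by rw [h])
      have : Λ j i ≠ 0 := by simpa [M, one_apply, hij, hij.symm] using hM
      exact ⟨hΛ j i this, by simp⟩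
    · have : Ω i j ≠ 0 := by simpa [M] using hM
      exact ⟨or_iff_not_imp_left.2 fun hij => hΩ i j hij this, by simp⟩
    · simp [M] at hM
    · have hij : i ≠ j := fun h => hx (by rw [h])
      have h1 : ¬ (i ∈ W ∧ j = v) ∧ Λ i j ≠ 0 := by
        simpa [M, hij, Λs] using hM
      refine ⟨hΛ i j h1.2, ?_⟩
      rintro ⟨⟨a, ha, hia⟩, hj⟩
      rw [Sum.inr.injEq] at hia hj
      exact h1.1 ⟨hia ▸ ha, hj⟩)
  rw [hcardS, hrange] at hmem
  exact absurd ((isGreatest_maxFlow _ _ _).2 hmem) (not_le.2 hflow)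

end MixedGraph


/-! ### Generic properties -/

namespace MixedGraph

open Matrix

variable {V : Type*} (G : MixedGraph V)

/-- Restriction to a line reduces questions about generic nonvanishing to polynomials in one
variable. -/
theorem _root_.ParamPoly.exists_eval_eq_evalAt_line (p : ParamPoly V) (θ η : ParamPair V) :
    ∃ f : Polynomial ℝ, ∀ r, f.eval r = p.evalAt (θ + r • (η - θ)) := by
  refine ⟨MvPolynomial.eval₂ Polynomial.C (Sum.elim
    (fun e => Polynomial.C (θ.1 e.1 e.2) + Polynomial.X * Polynomial.C (η.1 e.1 e.2 - θ.1 e.1 e.2))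
    (fun e => Polynomial.C (θ.2 e.1 e.2) + Polynomial.X * Polynomial.C (η.2 e.1 e.2 - θ.2 e.1 e.2)))
    p, fun r => ?_⟩
  simp only [ParamPoly.evalAt]
  induction p using MvPolynomial.induction_on with
  | C a => simp
  | add p q hp hq => simp only [MvPolynomial.eval₂_add, Polynomial.eval_add, hp, hq, map_add]
  | mul_X p i hp =>
    rw [MvPolynomial.eval₂_mul, Polynomial.eval_mul, hp, map_mul]
    congr 1
    rcases i with i | i <;> simp

variable (V) in
/-- The matrix of coordinate functions on the directed part of the parameter space. -/
def genericDir : Matrix V V (ParamPoly V) := of fun a b => MvPolynomial.X (Sum.inl (a, b))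

variable (V) in
/-- The matrix of coordinate functions on the error covariance part of the parameter space. -/
def genericCov : Matrix V V (ParamPoly V) := of fun a b => MvPolynomial.X (Sum.inr (a, b))

/-- Evaluation of polynomials at a parameter. -/
def evalHom (θ : ParamPair V) : ParamPoly V →+* ℝ :=
  MvPolynomial.eval (Sum.elim (fun e => θ.1 e.1 e.2) (fun e => θ.2 e.1 e.2))

theorem map_genericCov (θ : ParamPair V) : (genericCov V).map (evalHom θ) = θ.2 := by
  ext a b
  simp [genericCov, evalHom]

variable [DecidableEq V]

theorem map_one_sub_genericDir (θ : ParamPair V) :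
    (1 - genericDir V).map (evalHom θ) = 1 - θ.1 := by
  ext a b
  by_cases h : a = b <;> simp [genericDir, evalHom, h]

variable [Fintype V]

/-- A proper algebraic subset lies in the zero set of a single one of its polynomials that does not
vanish identically on the parameter space. -/
theorem generically_iff {Q : ParamPair V → Prop} :
    G.Generically Q ↔ ∃ p : ParamPoly V, (∃ θ ∈ G.paramSpace, p.evalAt θ ≠ 0) ∧
      ∀ θ ∈ G.paramSpace, p.evalAt θ ≠ 0 → Q θ := by
  constructor
  · rintro ⟨A, ⟨⟨P, rfl⟩, hA⟩, hQ⟩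
    obtain ⟨θ, hθ, p, hp, hpθ⟩ : ∃ θ ∈ G.paramSpace, ∃ p ∈ P, p.evalAt θ ≠ 0 := by
      by_contra! hcon
      exact hA (Set.Subset.antisymm (fun θ h => h.1) fun θ h => ⟨h, hcon θ h⟩)
    exact ⟨p, ⟨θ, hθ, hpθ⟩, fun η hη h => hQ η ⟨hη, fun h' => h (h'.2 p hp)⟩⟩
  · rintro ⟨p, ⟨θ, hθ, hpθ⟩, hQ⟩
    refine ⟨{θ ∈ G.paramSpace | ∀ q ∈ ({p} : Set (ParamPoly V)), q.evalAt θ = 0}, ⟨⟨{p}, rfl⟩, ?_⟩,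
      fun η hη => hQ η hη.1 fun h => hη.2 ⟨hη.1, by simpa using h⟩⟩
    intro h
    rw [← h] at hθ
    exact hpθ (hθ.2 p rfl)

theorem evalAt_det_one_sub (θ : ParamPair V) :
    ParamPoly.evalAt (1 - genericDir V).det θ = (1 - θ.1).det := by
  change evalHom θ _ = _
  rw [RingHom.map_det, RingHom.mapMatrix_apply, map_one_sub_genericDir]

/-- A polynomial whose nonvanishing locus on the parameter space is that of a minor of the
covariance matrix. -/
def minorPoly {k : Type*} [Fintype k] [DecidableEq k] (s t : k → V) : ParamPoly V :=
  (((1 - genericDir V).adjugateᵀ * genericCov V * (1 - genericDir V).adjugate).submatrix s t).det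

/-- The adjugate differs from the inverse by the factor det(1 − Λ), which is nonzero here. -/
theorem evalAt_minorPoly_ne_zero_iff {k : Type*} [Fintype k] [DecidableEq k] (s t : k → V)
    {θ : ParamPair V} (hθ : IsUnit (1 - θ.1)) :
    (minorPoly s t).evalAt θ ≠ 0 ↔ ((covariance θ).submatrix s t).det ≠ 0 := by
  have h1 : (minorPoly s t).evalAt θ =
      (((1 - θ.1).adjugateᵀ * θ.2 * (1 - θ.1).adjugate).submatrix s t).det := by
    change evalHom θ _ = _
    rw [minorPoly, RingHom.map_det, RingHom.mapMatrix_apply, ← submatrix_map, Matrix.map_mul,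
      Matrix.map_mul, map_genericCov, transpose_map,
      ← RingHom.mapMatrix_apply (evalHom θ) (1 - genericDir V).adjugate, RingHom.map_adjugate,
      RingHom.mapMatrix_apply, map_one_sub_genericDir]
  have h2 : (1 - θ.1).det ≠ 0 := ((isUnit_iff_isUnit_det _).1 hθ).ne_zero
  rw [h1, adjugate_eq_det_smul_inv_of_isUnit hθ, transpose_smul, Matrix.smul_mul, Matrix.smul_mul,
    Matrix.mul_smul, smul_smul, submatrix_smul, Pi.smul_apply, Pi.smul_apply, det_smul, covariance]
  exact ⟨right_ne_zero_of_mul, mul_ne_zero (pow_ne_zero _ (mul_ne_zero h2 h2))⟩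

/-- A minor of the covariance matrix that is nonzero somewhere is generically nonzero. -/
theorem generically_det_ne_zero {k : Type*} [Fintype k] [DecidableEq k] {s t : k → V}
    (h : ∃ θ ∈ G.paramSpace, ((covariance θ).submatrix s t).det ≠ 0) :
    G.Generically fun θ => ((covariance θ).submatrix s t).det ≠ 0 := by
  obtain ⟨θ, hθ, h⟩ := h
  exact G.generically_iff.2 ⟨minorPoly s t, ⟨θ, hθ, (evalAt_minorPoly_ne_zero_iff s t hθ.2.1).2 h⟩,
    fun η hη => (evalAt_minorPoly_ne_zero_iff s t hη.2.1).1⟩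

/-- The interior of a segment with ends in the parameter space lies in the parameter space, as far
as `1 - Λ` is invertible. -/
theorem line_mem_paramSpace {θ η : ParamPair V} (hθ : θ ∈ G.paramSpace) (hη : η ∈ G.paramSpace)
    {r : ℝ} (hr : r ∈ Set.Ioo (0 : ℝ) 1) (hdet : (1 - (θ + r • (η - θ)).1).det ≠ 0) :
    θ + r • (η - θ) ∈ G.paramSpace := by
  refine ⟨fun a b hab => ?_, ?_, ?_, fun a b hne hab => ?_⟩
  · by_contra hG
    have h1 : θ.1 a b = 0 := by_contra fun h => hG (hθ.1 a b h)
    have h2 : η.1 a b = 0 := by_contra fun h => hG (hη.1 a b h)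
    simp [h1, h2] at hab
  · rwa [isUnit_iff_isUnit_det, isUnit_iff_ne_zero]
  · have h1 : (θ + r • (η - θ)).2 = (1 - r) • θ.2 + r • η.2 := by
      simp only [Prod.snd_add, Prod.smul_snd, Prod.snd_sub]
      module
    rw [h1]
    exact (hθ.2.2.1.smul (sub_pos.2 hr.2)).add (hη.2.2.1.smul hr.1)
  · by_contra hG
    have h1 : θ.2 a b = 0 := by_contra fun h => hG (hθ.2.2.2 a b hne h)
    have h2 : η.2 a b = 0 := by_contra fun h => hG (hη.2.2.2 a b hne h)
    simp [h1, h2] at hab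

/-- This is irreducibility of the parameter space. On a segment joining witnesses for `p` and `q`,
the polynomials `p`, `q` and det(1 − Λ) restrict to nonzero polynomials, so some interior point
avoids all their zeros; invertibility is the only condition that could fail there. -/
theorem exists_evalAt_mul_ne_zero {p q : ParamPoly V} (hp : ∃ θ ∈ G.paramSpace, p.evalAt θ ≠ 0)
    (hq : ∃ θ ∈ G.paramSpace, q.evalAt θ ≠ 0) :
    ∃ θ ∈ G.paramSpace, p.evalAt θ ≠ 0 ∧ q.evalAt θ ≠ 0 := by
  obtain ⟨θ, hθ, hp⟩ := hp
  obtain ⟨η, hη, hq⟩ := hq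
  obtain ⟨f, hf⟩ := p.exists_eval_eq_evalAt_line θ η
  obtain ⟨g, hg⟩ := q.exists_eval_eq_evalAt_line θ η
  obtain ⟨h, hh⟩ := ParamPoly.exists_eval_eq_evalAt_line (1 - genericDir V).det θ η
  have e₀ : θ + (0 : ℝ) • (η - θ) = θ := by simp
  have e₁ : θ + (1 : ℝ) • (η - θ) = η := by simp
  have hf0 : f ≠ 0 := fun h0 => hp (by rw [← e₀, ← hf, h0, Polynomial.eval_zero])
  have hg0 : g ≠ 0 := fun h0 => hq (by rw [← e₁, ← hg, h0, Polynomial.eval_zero])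
  have hh0 : h ≠ 0 := fun h0 => ((isUnit_iff_isUnit_det _).1 hθ.2.1).ne_zero (by
    rw [← evalAt_det_one_sub, ← e₀, ← hh, h0, Polynomial.eval_zero])
  obtain ⟨r, hr, hne⟩ : ∃ r ∈ Set.Ioo (0 : ℝ) 1, (f * (g * h)).eval r ≠ 0 := by
    by_contra! hcon
    exact mul_ne_zero hf0 (mul_ne_zero hg0 hh0) (Polynomial.eq_zero_of_infinite_isRoot _
      ((Set.Ioo_infinite zero_lt_one).mono hcon))
  rw [Polynomial.eval_mul, Polynomial.eval_mul, hf, hg, hh, evalAt_det_one_sub] at hne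
  exact ⟨_, G.line_mem_paramSpace hθ hη hr (right_ne_zero_of_mul (right_ne_zero_of_mul hne)),
    left_ne_zero_of_mul hne, left_ne_zero_of_mul (right_ne_zero_of_mul hne)⟩

variable {G}

theorem Generically.and {Q R : ParamPair V → Prop} (hQ : G.Generically Q) (hR : G.Generically R) :
    G.Generically fun θ => Q θ ∧ R θ := by
  rw [generically_iff] at *
  obtain ⟨p, hp, hpQ⟩ := hQ
  obtain ⟨q, hq, hqR⟩ := hR
  obtain ⟨θ, hθ, h1, h2⟩ := G.exists_evalAt_mul_ne_zero hp hq
  have hmul : ∀ η, ParamPoly.evalAt (p * q) η = p.evalAt η * q.evalAt η := fun η => map_mul _ _ _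
  refine ⟨p * q, ⟨θ, hθ, by rw [hmul]; exact mul_ne_zero h1 h2⟩, fun η hη h => ?_⟩
  rw [hmul] at h
  exact ⟨hpQ η hη (left_ne_zero_of_mul h), hqR η hη (right_ne_zero_of_mul h)⟩

theorem Generically.mono {Q R : ParamPair V → Prop} (hQ : G.Generically Q)
    (h : ∀ θ ∈ G.paramSpace, Q θ → R θ) : G.Generically R := by
  obtain ⟨A, hA, hQ⟩ := hQ
  exact ⟨A, hA, fun θ hθ => h θ hθ.1 (hQ θ hθ)⟩

variable (G) in
theorem paramSpace_nonempty : G.paramSpace.Nonempty :=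
  ⟨(0, 1), by simp, by simp, PosDef.one, fun a b hab h => absurd (one_apply_ne hab) h⟩

theorem generically_forall {ι : Type*} [Finite ι] {Q : ι → ParamPair V → Prop}
    (hQ : ∀ i, G.Generically (Q i)) : G.Generically fun θ => ∀ i, Q i θ := by
  classical
  have := Fintype.ofFinite ι
  have key : ∀ I : Finset ι, G.Generically fun θ => ∀ i ∈ I, Q i θ := by
    intro I
    induction I using Finset.induction_on with
    | empty =>
      obtain ⟨θ, hθ⟩ := G.paramSpace_nonempty
      exact G.generically_iff.2 ⟨1, ⟨θ, hθ, by simp [ParamPoly.evalAt]⟩, by simp⟩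
    | insert i I _ ih =>
      refine ((hQ i).and ih).mono fun θ _ h => ?_
      simpa using h
  exact (key Finset.univ).mono fun θ _ h i => h i (Finset.mem_univ i)

end MixedGraph

/-! ### Values of rational functions -/

namespace RatFun

variable {V : Type*} {M : Matrix V V ℝ}

theorem algebraMap_ne_zero_of_eval_ne_zero {q : MvPolynomial (V × V) ℝ} {x : V × V → ℝ}
    (hq : MvPolynomial.eval x q ≠ 0) : algebraMap _ (RatFun V) q ≠ 0 := by
  intro h
  rw [IsFractionRing.to_map_eq_zero_iff] at h
  rw [h, map_zero] at hq
  exact hq rfl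

theorem hasValueAt_algebraMap (p : MvPolynomial (V × V) ℝ) (M : Matrix V V ℝ) :
    HasValueAt (algebraMap _ (RatFun V) p) M (MvPolynomial.eval (fun e => M e.1 e.2) p) :=
  ⟨p, 1, by simp, by simp, by simp⟩

theorem HasValueAt.add {φ ψ : RatFun V} {c d : ℝ} (hφ : φ.HasValueAt M c)
    (hψ : ψ.HasValueAt M d) : HasValueAt (φ + ψ) M (c + d) := by
  obtain ⟨p, q, hq, rfl, rfl⟩ := hφ
  obtain ⟨p', q', hq', rfl, rfl⟩ := hψ
  refine ⟨p * q' + q * p', q * q', by rw [map_mul]; exact mul_ne_zero hq hq', ?_, ?_⟩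
  · rw [div_add_div _ _ (algebraMap_ne_zero_of_eval_ne_zero hq)
      (algebraMap_ne_zero_of_eval_ne_zero hq')]
    simp only [map_add, map_mul]
  · rw [div_add_div _ _ hq hq']
    simp only [map_add, map_mul]

theorem HasValueAt.neg {φ : RatFun V} {c : ℝ} (hφ : φ.HasValueAt M c) :
    HasValueAt (-φ) M (-c) := by
  obtain ⟨p, q, hq, rfl, rfl⟩ := hφ
  exact ⟨-p, q, hq, by rw [map_neg, neg_div], by rw [map_neg, neg_div]⟩

theorem HasValueAt.sub {φ ψ : RatFun V} {c d : ℝ} (hφ : φ.HasValueAt M c)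
    (hψ : ψ.HasValueAt M d) : HasValueAt (φ - ψ) M (c - d) := by
  rw [sub_eq_add_neg, sub_eq_add_neg]
  exact hφ.add hψ.neg

theorem HasValueAt.mul {φ ψ : RatFun V} {c d : ℝ} (hφ : φ.HasValueAt M c)
    (hψ : ψ.HasValueAt M d) : HasValueAt (φ * ψ) M (c * d) := by
  obtain ⟨p, q, hq, rfl, rfl⟩ := hφ
  obtain ⟨p', q', hq', rfl, rfl⟩ := hψ
  refine ⟨p * p', q * q', by rw [map_mul]; exact mul_ne_zero hq hq', ?_, ?_⟩
  · rw [div_mul_div_comm, map_mul, map_mul]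
  · rw [div_mul_div_comm, map_mul, map_mul]

theorem HasValueAt.div {φ ψ : RatFun V} {c d : ℝ} (hφ : φ.HasValueAt M c)
    (hψ : ψ.HasValueAt M d) (hd : d ≠ 0) : HasValueAt (φ / ψ) M (c / d) := by
  obtain ⟨p, q, hq, rfl, rfl⟩ := hφ
  obtain ⟨p', q', hq', rfl, rfl⟩ := hψ
  have hp' := (div_ne_zero_iff.1 hd).1
  refine ⟨p * q', q * p', by rw [map_mul]; exact mul_ne_zero hq hp', ?_, ?_⟩
  · rw [div_div_div_eq, map_mul, map_mul]
  · rw [div_div_div_eq, map_mul, map_mul]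

theorem HasValueAt.sum {ι : Type*} {I : Finset ι} {φ : ι → RatFun V} {c : ι → ℝ}
    (h : ∀ i ∈ I, (φ i).HasValueAt M (c i)) : HasValueAt (∑ i ∈ I, φ i) M (∑ i ∈ I, c i) := by
  classical
  induction I using Finset.induction_on with
  | empty => simpa using hasValueAt_algebraMap (0 : MvPolynomial (V × V) ℝ) M
  | insert i I hi ih =>
    rw [Finset.sum_insert hi, Finset.sum_insert hi]
    exact (h i (Finset.mem_insert_self i I)).add
      (ih fun j hj => h j (Finset.mem_insert_of_mem hj))

theorem hasValueAt_extSubdet (M : Matrix V V ℝ) {m : ℕ} (s : Fin (m + 1) → V) (t : Fin m → V)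
    (x : V) : HasValueAt (extSubdet (coordMatrix V) s t x) M (extSubdet M s t x) := by
  let N : Matrix V V (MvPolynomial (V × V) ℝ) := Matrix.of fun a b => MvPolynomial.X (a, b)
  have hN : extSubdet (coordMatrix V) s t x = algebraMap _ (RatFun V) (extSubdet N s t x) := by
    rw [extSubdet, extSubdet, RingHom.map_det]
    rfl
  have hM : extSubdet M s t x = MvPolynomial.eval (fun e => M e.1 e.2) (extSubdet N s t x) := by
    rw [extSubdet, extSubdet, RingHom.map_det]
    congr 1
    ext i j
    simp [N]
  rw [hN, hM]
  exact hasValueAt_algebraMap _ M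

theorem hasValueAt_detRatio {M : Matrix V V ℝ} {m l : ℕ} {s : Fin (m + 1) → V} {t : Fin m → V}
    {v w₀ : V} {w : Fin l → V} {ψ : Fin l → RatFun V} {c : Fin l → ℝ}
    (h₀ : extSubdet M s t w₀ ≠ 0) (hψ : ∀ i, (ψ i).HasValueAt M (c i)) :
    HasValueAt (detRatio (coordMatrix V) s t v w₀ w ψ) M (detRatio M s t v w₀ w c) :=
  HasValueAt.div ((hasValueAt_extSubdet M s t v).sub
    (HasValueAt.sum fun i _ => (hψ i).mul (hasValueAt_extSubdet M s t (w i))))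
    (hasValueAt_extSubdet M s t w₀) h₀

end RatFun

end

/-! ### Assembly of the theorem -/

theorem mainTheorem1 {V : Type*} [Fintype V] [DecidableEq V] (G : MixedGraph V)
    (v w₀ : V) (hw₀ : G.dir w₀ v)
    {l : ℕ} (w : Fin l → V) (hw : ∀ i, G.dir (w i) v)
    (hw_inj : Function.Injective w) (hw_ne : ∀ i, w i ≠ w₀)
    {m : ℕ}
    (S T : Set V)
    (s : Fin (m + 1) → V) (hs : Function.Injective s) (hS : Set.range s = S)
    (t : Fin m → V) (ht : Function.Injective t) (hT : Set.range t = T)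
    (hvT : v ∉ T) (hwT : w₀ ∉ T)
    (ha : G.des v ∩ (T ∪ {v}) = ∅)
    (hb : maxFlow G.flowGraph (Sum.inl '' S) (Sum.inr '' (T ∪ {w₀})) = ((m + 1 : ℕ) : ℝ))
    (hc : maxFlow (G.flowGraphDelete ({w₀} ∪ Set.range w) v)
      (Sum.inl '' S) (Sum.inr '' (T ∪ {v})) < ((m + 1 : ℕ) : ℝ)) :
    -- the equation holds generically, with a generically nonzero denominator
    (G.Generically fun θ =>
      extSubdet (MixedGraph.covariance θ) s t w₀ ≠ 0 ∧
      θ.1 w₀ v = detRatio (MixedGraph.covariance θ) s t v w₀ w (fun i => θ.1 (w i) v)) ∧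
    -- generic identifiability
    ((∀ i, G.GenericallyIdentifiable (w i) v) → G.GenericallyIdentifiable w₀ v) ∧
    -- rational identifiability
    ((∀ i, G.RationallyIdentifiable (w i) v) → G.RationallyIdentifiable w₀ v) ∧
    -- rational identifiability, by the equation
    (∀ ψ : Fin l → RatFun V, (∀ i, G.RationallyIdentifiedBy (ψ i) (w i) v) →
      G.RationallyIdentifiedBy (detRatio (coordMatrix V) s t v w₀ w ψ) w₀ v) := by
  subst hS hT
  have hdes : ∀ a ∈ G.des v, a ≠ v ∧ a ∉ Set.range t := fun a hav =>
    ⟨fun h => Set.eq_empty_iff_forall_notMem.1 ha a ⟨hav, Or.inr h⟩,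
      fun h => Set.eq_empty_iff_forall_notMem.1 ha a ⟨hav, Or.inl h⟩⟩
  -- The formula is kept for every parameter with nonzero denominator, since identifiability must
  -- apply it to arbitrary points of a fiber, which need not be generic.
  have heq : ∀ θ ∈ G.paramSpace, extSubdet (MixedGraph.covariance θ) s t w₀ ≠ 0 →
      θ.1 w₀ v = detRatio (MixedGraph.covariance θ) s t v w₀ w (fun i => θ.1 (w i) v) := by
    intro θ hθ hne
    have hW : ∀ a ∈ ({w₀} ∪ Set.range w : Set V), G.dir a v := by
      rintro a (rfl | ⟨i, rfl⟩)
      exacts [hw₀, hw i]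
    have h1 := G.extSubdet_eq_sum_of_maxFlow_lt hs ht hvT hW hdes hc hθ
    -- `Option (Fin l)` lists `w₀` together with the `w i` without repetition, so the sum over `V`
    -- collapses to these columns.
    have hinj : Function.Injective (fun o : Option (Fin l) => o.elim w₀ w) := by
      rintro (_ | i) (_ | j) h
      · rfl
      · exact absurd h.symm (hw_ne j)
      · exact absurd h (hw_ne i)
      · exact congrArg some (hw_inj h)
    rw [sum_eq_sum_of_injective hinj, Fintype.sum_option] at h1
    · simp only [Option.elim_none, Option.elim_some, Set.mem_union, Set.mem_singleton_iff, true_or,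
        Set.mem_range, exists_apply_eq_apply, or_true, if_true] at h1
      rw [detRatio, eq_div_iff hne, h1]
      ring
    · intro a ha
      rw [if_neg, zero_mul]
      rintro (rfl | ⟨i, rfl⟩)
      exacts [ha ⟨none, rfl⟩, ha ⟨some i, rfl⟩]
  have hgen : G.Generically fun θ => extSubdet (MixedGraph.covariance θ) s t w₀ ≠ 0 :=
    G.generically_det_ne_zero (G.exists_det_covariance_ne_zero_of_maxFlow hs
      (Fin.snoc_injective_iff.2 ⟨ht, hwT⟩) (by rwa [Fin.range_snoc, ← Set.union_singleton]))
  have hrat : ∀ ψ : Fin l → RatFun V, (∀ i, G.RationallyIdentifiedBy (ψ i) (w i) v) →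
      G.RationallyIdentifiedBy (detRatio (coordMatrix V) s t v w₀ w ψ) w₀ v := by
    intro ψ hψ
    refine (hgen.and (MixedGraph.generically_forall hψ)).mono fun θ hθ h => ?_
    rw [heq θ hθ h.1]
    exact RatFun.hasValueAt_detRatio h.1 h.2
  refine ⟨hgen.mono fun θ hθ h => ⟨h, heq θ hθ h⟩, fun hid => ?_, fun hid => ?_, hrat⟩
  · refine (hgen.and (MixedGraph.generically_forall hid)).mono fun θ hθ h => ?_
    refine Set.eq_singleton_iff_unique_mem.2 ⟨⟨θ, ⟨hθ, rfl⟩, rfl⟩, ?_⟩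
    rintro _ ⟨η, ⟨hη, hcov⟩, rfl⟩
    have hηw : ∀ i, η.1 (w i) v = θ.1 (w i) v := fun i => by
      have : η.1 (w i) v ∈ ({θ.1 (w i) v} : Set ℝ) := h.2 i ▸ ⟨η, ⟨hη, hcov⟩, rfl⟩
      exact this
    -- The denominator depends on Σ alone, so it is nonzero at `η` too, and both parameters have the
    -- same right-hand side.
    have h1 := heq η hη (by rw [hcov]; exact h.1)
    simp only [hcov, hηw] at h1
    rw [← heq θ hθ h.1] at h1
    exact h1
  · choose ψ hψ using hid
    exact ⟨_, hrat ψ hψ⟩
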